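/- **Setting.** Let $d\ge 1$ and let $X=\{X_t,\ t\in\mathbb{R}\}$ be an $\mathbb{R}^d$-valued process on a probability space $(\Omega,\mathcal F,P)$ such that all $X_t$ have the same density $f$ and, for all $s\neq t$, the pair $(X_s,X_t)$ has a density $f_{|t-s|}$ that depends on $(s,t)$ only through $|t-s|$. Put $g_u(y,z)=f_u(y,z)-f(y)f(z)$ for $u>0$, and $$\alpha_X^{(2)}(u)=\sup_{t\in\mathbb{R}}\ \sup_{A\in\sigma(X_t),\,B\in\sigma(X_{t+u})}|P(A\cap B)-P(A)P(B)|.$$ **Sampling.** The process is observed at random times $t_1,t_2,\dots$ that are independent of it. More precisely, $(t_k)_{k\ge0}$ is independent of a sub-$\sigma$-algebra $\mathcal G\subseteq\mathcal F$ such that $(s,\omega)\mapsto X_s(\omega)$, $s\ge 0$, is $\mathcal B([0,\infty))\otimes\mathcal G$-measurable. The times are of one of two types. * *Renewal sampling*: $t_0=0$ and $t_k=\tau_1+\dots+\tau_k$, where the $\tau_j$ are almost surely positive i.i.d. random variables with a density $g$ and finite mean, and the renewal density $h=\sum_{k\ge1}g^{\star k}$ (where $g^{\star k}$ is the $k$-fold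 convolution of $g$ with itself) is bounded by a constant $h_0$ on $(0,\infty)$. * *Jittered sampling*: $t_k=k\delta+Z_k$ for $k\ge0$, where $\delta>0$ and the $Z_k$ are i.i.d. with a symmetric density vanishing outside $[-\delta/2,\delta/2]$. **Estimator.** For a bin width $h_n>0$ and a grid origin $b_n\in\mathbb{R}^d$ (arbitrary and possibly depending on $n$), let $\pi_{nj}=\prod_{i=1}^d[b_{n,i}+j_ih_n,\ b_{n,i}+(j_i+1)h_n)$ for $j\in\mathbb{Z}^d$, and $$\hat f_n^H(x)=\sum_{j\in\mathbb{Z}^d}\Big[\frac1{nh_n^d}\sum_{k=1}^n\mathbf 1_{\pi_{nj}}(X_{t_k})\Big]\mathbf 1_{\pi_{nj}}(x).$$ Write $\mathrm{IV}(\hat f_n^H)=\int_{\mathbb{R}^d}E\big(\hat f_n^H(x)-E\hat f_n^H(x)\big)^2dx$, $\mathrm{MISE}(\hat f_n^H)=E\int_{\mathbb{R}^d}\big(\hat f_n^H(x)-f(x)\big)^2dx$, and $R_d(f')=\sum_{i=1}^d\int_{\mathbb{R}^d}(\partial f/\partial x_i)^2dx$. **Assumptions.** * $A_0(i)$: $f\in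 C^2(\mathbb{R}^d)$ and the partial derivatives $\partial f/\partial x_i$ are square integrable. * $A_0(ii)$: $f$ is continuous and bounded. * $A_1(i)$: there is $u_0>0$ such that for all $u\ge u_0$ and all $y\in\mathbb{R}^d$, $\sup_{z}|g_u(y,z)|\le k(y)$, with $k$ a positive, continuous and integrable function on $\mathbb{R}^d$. * $A_1(ii)$: there are $\rho>2$, $a_0>0$ and $u_1>u_0$ such that $\alpha_X^{(2)}(u)\le a_0u^{-\rho}$ for all $u\ge u_1$. **Theorem.** Assume $A_0(ii)$, $A_1(i)$ and $A_1(ii)$, and that $f^{1-1/p}\in C^1(\mathbb{R}^d)\cap L_1(\mathbb{R}^d)$ for some $1<p<\rho-1$. Let $C=2u_0h_0$ for renewal sampling and $C=2\lceil u_0/\delta\rceil$ for jittered sampling. 1. If $h_n\to0$ and $nh_n^d\to\infty$ as $n\to\infty$, then $$\limsup_{n\to\infty}\ nh_n^d\,\mathrm{IV}(\hat f_n^H)\le 1+C.$$ 2. If in addition $A_0(i)$ holds and $h_n=cn^{-1/(d+2)}$ with $0<c<\infty$, then $$\limsup_{n\to\infty}\ n^{2/(d+2)}\,\mathrm{MISE}(\hat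 f_n^H)\le\frac{c^2}{12}R_d(f')+\frac1{c^d}(1+C).$$ -/

import Mathlib

open MeasureTheory ProbabilityTheory Filter
open scoped ENNReal NNReal Topology

noncomputable section

namespace SampledHistogram

/-- A measure `μ` has the (everywhere defined, nonnegative, measurable) density `f` with respect
to the reference measure. -/
structure IsDensity {E : Type*} [MeasureSpace E] (μ : Measure E) (f : E → ℝ) : Prop where
  measurable : Measurable f
  nonneg : ∀ x, 0 ≤ f x
  eq_withDensity : μ = (volume : Measure E).withDensity (fun x => ENNReal.ofReal (f x))

/-- The process `X` has common marginal density `f`, and for all `s ≠ t` the pair `(X s, X t)` has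
a density which depends on `(s, t)` only through `|t - s|` and is given by `fJ |t - s|`. -/
structure IsPairStationary {Ω : Type*} {mΩ : MeasurableSpace Ω} (P : Measure Ω) {d : ℕ}
    (X : ℝ → Ω → (Fin d → ℝ)) (f : (Fin d → ℝ) → ℝ)
    (fJ : ℝ → (Fin d → ℝ) → (Fin d → ℝ) → ℝ) : Prop where
  measurable : ∀ t, Measurable (X t)
  marginal : ∀ t, IsDensity (P.map (X t)) f
  joint : ∀ s t, s ≠ t →
    IsDensity (P.map (fun ω => (X s ω, X t ω))) (fun q => fJ |t - s| q.1 q.2)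

/-- `g_u = f_u - f ⊗ f`. -/
def jointDeviation {d : ℕ} (f : (Fin d → ℝ) → ℝ) (fJ : ℝ → (Fin d → ℝ) → (Fin d → ℝ) → ℝ)
    (u : ℝ) (y z : Fin d → ℝ) : ℝ :=
  fJ u y z - f y * f z

/-- The strong mixing coefficient `sup |P (A ∩ B) - P A * P B|` of two `σ`-algebras. -/
def alphaCoeff {Ω : Type*} {mΩ : MeasurableSpace Ω} (P : Measure Ω)
    (m₁ m₂ : MeasurableSpace Ω) : ℝ :=
  sSup {a : ℝ | ∃ A B : Set Ω, MeasurableSet[m₁] A ∧ MeasurableSet[m₂] B ∧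
    a = |P.real (A ∩ B) - P.real A * P.real B|}

/-- The `2`-`α`-mixing coefficient `sup_t α (σ(X t), σ(X (t + u)))`. -/
def alphaTwo {Ω : Type*} {mΩ : MeasurableSpace Ω} (P : Measure Ω) {d : ℕ}
    (X : ℝ → Ω → (Fin d → ℝ)) (u : ℝ) : ℝ :=
  ⨆ t : ℝ, alphaCoeff P (MeasurableSpace.comap (X t) inferInstance)
    (MeasurableSpace.comap (X (t + u)) inferInstance)

/-- `f` is twice continuously differentiable with square integrable partial derivatives. -/
structure BiasAssumption {d : ℕ} (f : (Fin d → ℝ) → ℝ) : Prop where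
  contDiff : ContDiff ℝ 2 f
  sq_integrable : ∀ i, Integrable (fun x => (fderiv ℝ f x (Pi.single i 1)) ^ 2)

/-- `f` is continuous and bounded. -/
structure BoundedDensity {d : ℕ} (f : (Fin d → ℝ) → ℝ) : Prop where
  continuous : Continuous f
  bddAbove : BddAbove (Set.range f)

/-- The bound on `g_u` for `u ≥ u₀` and the arithmetic `2`-`α`-mixing with exponent `ρ > 2`. -/
structure MixingAssumption {Ω : Type*} {mΩ : MeasurableSpace Ω} (P : Measure Ω) {d : ℕ}
    (X : ℝ → Ω → (Fin d → ℝ)) (f : (Fin d → ℝ) → ℝ)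
    (fJ : ℝ → (Fin d → ℝ) → (Fin d → ℝ) → ℝ) (u₀ ρ : ℝ) : Prop where
  u₀_pos : 0 < u₀
  deviation : ∃ k : (Fin d → ℝ) → ℝ, (∀ y, 0 < k y) ∧ Continuous k ∧ Integrable k ∧
    ∀ u, u₀ ≤ u → ∀ y z, |jointDeviation f fJ u y z| ≤ k y
  two_lt_ρ : 2 < ρ
  mixing : ∃ a₀ u₁ : ℝ, 0 < a₀ ∧ u₀ < u₁ ∧ ∀ u, u₁ ≤ u → alphaTwo P X u ≤ a₀ * u ^ (-ρ)

/-- The sequence of sampling times `t` is independent of the measurable process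
`(X s)_{s ≥ 0}`: the times are independent of a sub-`σ`-algebra `𝓖` for which
`(s, ω) ↦ X s ω`, `s ≥ 0`, is jointly measurable. -/
def IndepOfProcess {Ω : Type*} {mΩ : MeasurableSpace Ω} (P : Measure Ω) {d : ℕ}
    (X : ℝ → Ω → (Fin d → ℝ)) (t : ℕ → Ω → ℝ) : Prop :=
  ∃ 𝓖 : MeasurableSpace Ω, 𝓖 ≤ mΩ ∧
    Measurable[MeasurableSpace.prod NNReal.measurableSpace 𝓖]
      (fun q : ℝ≥0 × Ω => X (q.1 : ℝ) q.2) ∧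
    Indep 𝓖 (⨆ k, MeasurableSpace.comap (t k) inferInstance) P

/-- `convPow g k` is the `(k + 1)`-fold convolution of `g` with itself. -/
def convPow (g : ℝ → ℝ) : ℕ → ℝ → ℝ≥0∞
  | 0 => fun t => ENNReal.ofReal (g t)
  | k + 1 => fun t => ∫⁻ s, convPow g k (t - s) * ENNReal.ofReal (g s)

/-- The renewal density, the sum over `k ≥ 1` of the `k`-fold convolutions of `g`. -/
def renewalDensity (g : ℝ → ℝ) (t : ℝ) : ℝ≥0∞ := ∑' k, convPow g k t

/-- Renewal sampling times `t k = τ₁ + ⋯ + τ_k` (here `τ j` is the `(j + 1)`-st inter-arrival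
time), independent of the process, with renewal density bounded by `h₀`. -/
structure IsRenewalSampling {Ω : Type*} {mΩ : MeasurableSpace Ω} (P : Measure Ω) {d : ℕ}
    (X : ℝ → Ω → (Fin d → ℝ)) (t τ : ℕ → Ω → ℝ) (g : ℝ → ℝ) (h₀ : ℝ) : Prop where
  time_eq : ∀ k ω, t k ω = ∑ j ∈ Finset.range k, τ j ω
  measurable : ∀ j, Measurable (τ j)
  pos : ∀ j, ∀ᵐ ω ∂P, 0 < τ j ω
  indep : iIndepFun τ P
  density : ∀ j, IsDensity (P.map (τ j)) g
  finite_mean : Integrable (τ 0) P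
  renewal_le : ∀ s, 0 < s → renewalDensity g s ≤ ENNReal.ofReal h₀
  indep_process : IndepOfProcess P X t

/-- Jittered sampling times `t k = k δ + Z k`, independent of the process, with i.i.d. jitters
having a symmetric density `gJ` over `[-δ/2, δ/2]`. -/
structure IsJitteredSampling {Ω : Type*} {mΩ : MeasurableSpace Ω} (P : Measure Ω) {d : ℕ}
    (X : ℝ → Ω → (Fin d → ℝ)) (t Z : ℕ → Ω → ℝ) (gJ : ℝ → ℝ) (δ : ℝ) : Prop where
  δ_pos : 0 < δ
  time_eq : ∀ k ω, t k ω = k * δ + Z k ω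
  measurable : ∀ k, Measurable (Z k)
  indep : iIndepFun Z P
  density : ∀ k, IsDensity (P.map (Z k)) gJ
  symm : ∀ z, gJ (-z) = gJ z
  support : ∀ z, z ∉ Set.Icc (-(δ / 2)) (δ / 2) → gJ z = 0
  indep_process : IndepOfProcess P X t

/-- The half-open hypercube with index `j` of the grid with origin `b` and bin width `h`. -/
def bin {d : ℕ} (h : ℝ) (b : Fin d → ℝ) (j : Fin d → ℤ) : Set (Fin d → ℝ) :=
  Set.univ.pi fun i => Set.Ico (b i + j i * h) (b i + (j i + 1) * h)

/-- The histogram built from `X_{t_1}, …, X_{t_n}` on the grid with origin `b`, bin width `h`. -/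
def histogram {Ω : Type*} {d : ℕ} (X : ℝ → Ω → (Fin d → ℝ)) (t : ℕ → Ω → ℝ) (n : ℕ) (h : ℝ)
    (b : Fin d → ℝ) (x : Fin d → ℝ) (ω : Ω) : ℝ :=
  ∑' j : Fin d → ℤ,
    (1 / (n * h ^ d) *
      ∑ k ∈ Finset.Icc 1 n, (bin h b j).indicator (fun _ => (1 : ℝ)) (X (t k ω) ω)) *
    (bin h b j).indicator (fun _ => (1 : ℝ)) x

/-- Integrated variance of a random function `F x ω`. -/
def integratedVariance {Ω : Type*} {mΩ : MeasurableSpace Ω} (P : Measure Ω) {d : ℕ}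
    (F : (Fin d → ℝ) → Ω → ℝ) : ℝ≥0∞ :=
  ∫⁻ x, ∫⁻ ω, ENNReal.ofReal ((F x ω - ∫ ω', F x ω' ∂P) ^ 2) ∂P

/-- Mean integrated squared error of a random function `F x ω` as an estimator of `f`. -/
def mise {Ω : Type*} {mΩ : MeasurableSpace Ω} (P : Measure Ω) {d : ℕ}
    (F : (Fin d → ℝ) → Ω → ℝ) (f : (Fin d → ℝ) → ℝ) : ℝ≥0∞ :=
  ∫⁻ ω, (∫⁻ x, ENNReal.ofReal ((F x ω - f x) ^ 2)) ∂P

/-- `R_d(f')`, the sum of the integrals of the squared first order partial derivatives. -/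
def roughness {d : ℕ} (f : (Fin d → ℝ) → ℝ) : ℝ :=
  ∑ i, ∫ x, (fderiv ℝ f x (Pi.single i 1)) ^ 2

/-- Upper bound for the integrated variance of the histogram, along any bin widths `h n > 0` with
`h n → 0` and `n (h n)^d → ∞`, and any grid origins `b n`. -/
def VarianceRate {Ω : Type*} {mΩ : MeasurableSpace Ω} (P : Measure Ω) {d : ℕ}
    (X : ℝ → Ω → (Fin d → ℝ)) (t : ℕ → Ω → ℝ) (C : ℝ) : Prop :=
  ∀ (h : ℕ → ℝ) (b : ℕ → Fin d → ℝ), (∀ n, 1 ≤ n → 0 < h n) → Tendsto h atTop (𝓝 0) →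
    Tendsto (fun n : ℕ => (n : ℝ) * h n ^ d) atTop atTop →
    limsup (fun n : ℕ => ENNReal.ofReal ((n : ℝ) * h n ^ d) *
        integratedVariance P (histogram X t n (h n) (b n))) atTop
      ≤ ENNReal.ofReal (1 + C)

/-- Upper bound for the mean integrated squared error of the histogram, for the bin widths
`h n = c n ^ (-1 / (d + 2))`, every `c > 0`, and any grid origins `b n`. -/
def MISERate {Ω : Type*} {mΩ : MeasurableSpace Ω} (P : Measure Ω) {d : ℕ}
    (X : ℝ → Ω → (Fin d → ℝ)) (t : ℕ → Ω → ℝ) (f : (Fin d → ℝ) → ℝ) (C : ℝ) : Prop :=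
  ∀ (c : ℝ) (b : ℕ → Fin d → ℝ), 0 < c →
    limsup (fun n : ℕ => ENNReal.ofReal ((n : ℝ) ^ (2 / ((d : ℝ) + 2))) *
        mise P (histogram X t n (c * (n : ℝ) ^ (-1 / ((d : ℝ) + 2))) (b n)) f) atTop
      ≤ ENNReal.ofReal (c ^ 2 / 12 * roughness f + 1 / c ^ d * (1 + C))

end SampledHistogram

end

/-! The histogram is constant on each bin, so `n h ^ d` times its integrated variance is `1 / n`
times the sum over the bins of the variances of the bin counts. Expand these variances into
covariances of indicators. The diagonal terms contribute at most `n`, since the bin probabilities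
add up to at most one. For a pair `k < l`, condition on the times. As the marginal law of the
process does not depend on time, only the covariances at the fixed times `t k`, `t l` remain, to be
averaged over the times (`sum_eventCov_observed`).

Summed over the bins, the covariance at lag `u` has three upper bounds: `1` always; `h ^ d * ∫ k`
when `u ≥ u₀`; and four times the mixing coefficient at `u`, whatever the number of bins
(`sum_eventCov_le_four_mul`). The expected number of times after `t k` at lag below `u₀` is at most
`u₀ h₀` for renewal sampling and `⌈u₀ / δ⌉` for jittered sampling; doubling it, because of the
symmetry in `k` and `l`, gives the constant `C`. For the longer lags, the expected number of times
at lag in `[m, m + 1)` is bounded in `k` and `m`, so their share is at most a constant times a sum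
over `m` of terms which tend to zero with `h ^ d` and are dominated by a summable sequence of order
`m ^ (-ρ)`. Hence it vanishes in the limit.

The MISE adds the integrated squared bias, the squared `L²` distance from `f` to its bin averages.
On a bin, subtract from `f` the linear function whose slopes are the bin averages of the partial
derivatives. The linear part gives exactly `h ^ 2 / 12` per unit of squared slope and unit of
volume. A Poincaré inequality bounds the remainder by `h ^ 2` times the distance of the partial
derivatives to their bin averages, which is `o(1)` uniformly in the grid origin. -/

namespace SampledHistogram

/-! ### Geometry of the grid, and second moments of a cube -/

section Bins

variable {d : ℕ} {h : ℝ} {b : Fin d → ℝ}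

/-- Floors assign to each point exactly one index, so disjointness and covering of the bins both
follow. -/
theorem mem_bin_iff (hh : 0 < h) {j : Fin d → ℤ} {x : Fin d → ℝ} :
    x ∈ bin h b j ↔ (fun i => ⌊(x i - b i) / h⌋) = j := by
  simp only [bin, Set.mem_univ_pi, Set.mem_Ico, funext_iff, Int.floor_eq_iff, le_div_iff₀ hh,
    div_lt_iff₀ hh]
  refine forall_congr' fun i => ?_
  constructor <;> rintro ⟨h1, h2⟩ <;> constructor <;> linarith

theorem measurableSet_bin (j : Fin d → ℤ) : MeasurableSet (bin h b j) :=
  MeasurableSet.univ_pi fun _ => measurableSet_Ico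

theorem pairwise_disjoint_bin (hh : 0 < h) : Pairwise (Function.onFun Disjoint (bin h b)) := by
  intro i j hij
  refine Set.disjoint_left.2 fun x hx hy => hij ?_
  rw [mem_bin_iff hh] at hx hy
  exact hx.symm.trans hy

theorem iUnion_bin (hh : 0 < h) : ⋃ j, bin h b j = Set.univ :=
  Set.eq_univ_of_forall fun _ => Set.mem_iUnion.2 ⟨_, (mem_bin_iff hh).2 rfl⟩

theorem volume_bin (hh : 0 < h) (j : Fin d → ℤ) :
    volume (bin h b j) = ENNReal.ofReal (h ^ d) := by
  rw [bin, volume_pi_pi]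
  simp only [Real.volume_Ico]
  have : ∀ i, b i + ((j i : ℝ) + 1) * h - (b i + j i * h) = h := fun i => by ring
  simp [this, ENNReal.ofReal_pow hh.le]

theorem volume_real_bin (hh : 0 < h) (j : Fin d → ℤ) : volume.real (bin h b j) = h ^ d := by
  rw [Measure.real, volume_bin hh, ENNReal.toReal_ofReal (by positivity)]

theorem lintegral_eq_tsum_bin (hh : 0 < h) (b : Fin d → ℝ) (μ : Measure (Fin d → ℝ))
    (F : (Fin d → ℝ) → ℝ≥0∞) : ∫⁻ x, F x ∂μ = ∑' j, ∫⁻ x in bin h b j, F x ∂μ := by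
  rw [← lintegral_iUnion measurableSet_bin (pairwise_disjoint_bin hh), iUnion_bin hh,
    Measure.restrict_univ]

theorem bin_subset_Icc (j : Fin d → ℤ) : bin h b j ⊆
    Set.Icc (fun i => b i + j i * h) (fun i => b i + (j i + 1) * h) := fun _ hx =>
  ⟨fun i => (hx i trivial).1, fun i => (hx i trivial).2.le⟩

theorem convex_bin (j : Fin d → ℤ) : Convex ℝ (bin h b j) :=
  convex_pi fun _ _ => convex_Ico _ _

theorem abs_sub_le_of_mem_bin {j : Fin d → ℤ} {x y : Fin d → ℝ} (hx : x ∈ bin h b j)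
    (hy : y ∈ bin h b j) (i : Fin d) : |x i - y i| ≤ h := by
  have h1 := hx i trivial
  have h2 := hy i trivial
  rw [abs_le]
  constructor <;> nlinarith [h1.1, h1.2, h2.1, h2.2]

theorem integrableOn_bin {F : (Fin d → ℝ) → ℝ} (hF : Continuous F) (j : Fin d → ℤ) :
    IntegrableOn F (bin h b j) :=
  (hF.continuousOn.integrableOn_compact isCompact_Icc).mono_set (bin_subset_Icc j)

/-- The average of `F` over a bin. -/
noncomputable def binAverage (h : ℝ) (b : Fin d → ℝ) (j : Fin d → ℤ) (F : (Fin d → ℝ) → ℝ) : ℝ :=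
  (∫ x in bin h b j, F x) / h ^ d

/-- Pythagoras in `L²` of the bin: deviations from the average are orthogonal to constants. With
deterministic `a` it says that the average is the best constant; with `a` the histogram height it
separates variance from bias in the MISE. -/
theorem setIntegral_bin_sub_sq (hh : 0 < h) {F : (Fin d → ℝ) → ℝ} (hF : Continuous F)
    (j : Fin d → ℤ) (a : ℝ) :
    ∫ x in bin h b j, (a - F x) ^ 2 = h ^ d * (a - binAverage h b j F) ^ 2 +
      ∫ x in bin h b j, (F x - binAverage h b j F) ^ 2 := by
  have hd : h ^ d ≠ 0 := by positivity
  have key : ∀ c : ℝ, ∫ x in bin h b j, (c - F x) ^ 2 =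
      h ^ d * c ^ 2 - 2 * c * (∫ x in bin h b j, F x) + ∫ x in bin h b j, F x ^ 2 := by
    intro c
    have hc : ∀ x, (c - F x) ^ 2 = (c ^ 2 - 2 * c * F x) + F x ^ 2 := fun x => by ring
    simp only [hc]
    rw [integral_add, integral_sub, integral_const_mul, setIntegral_const, volume_real_bin hh,
      smul_eq_mul]
    · exact integrableOn_bin continuous_const j
    · exact integrableOn_bin (by fun_prop) j
    · exact integrableOn_bin (by fun_prop) j
    · exact integrableOn_bin (by fun_prop) j
  have h2 : ∀ x, (F x - binAverage h b j F) ^ 2 = (binAverage h b j F - F x) ^ 2 :=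
    fun x => by ring
  simp only [h2]
  rw [key, key, binAverage]
  field_simp
  ring

theorem setIntegral_bin_sub_average_sq_le (hh : 0 < h) {F : (Fin d → ℝ) → ℝ} (hF : Continuous F)
    (j : Fin d → ℤ) (a : ℝ) :
    ∫ x in bin h b j, (F x - binAverage h b j F) ^ 2 ≤ ∫ x in bin h b j, (F x - a) ^ 2 := by
  have h2 : ∀ x, (F x - a) ^ 2 = (a - F x) ^ 2 := fun x => by ring
  simp only [h2, setIntegral_bin_sub_sq hh hF j a]
  have : 0 ≤ h ^ d * (a - binAverage h b j F) ^ 2 := by positivity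
  linarith

theorem binAverage_sq_le (hh : 0 < h) {F : (Fin d → ℝ) → ℝ} (hF : Continuous F)
    (j : Fin d → ℤ) :
    h ^ d * binAverage h b j F ^ 2 ≤ ∫ x in bin h b j, F x ^ 2 := by
  have := setIntegral_bin_sub_sq (b := b) hh hF j 0
  simp only [zero_sub, neg_sq] at this
  rw [this]
  exact le_add_of_nonneg_right (integral_nonneg fun x => sq_nonneg _)

/-- The centre of a bin. -/
noncomputable def binCenter (h : ℝ) (b : Fin d → ℝ) (j : Fin d → ℤ) (i : Fin d) : ℝ :=
  b i + (j i + 1 / 2) * h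

theorem setIntegral_bin_prod_center (hh : 0 < h) (φ : Fin d → ℝ → ℝ) (j : Fin d → ℤ) :
    ∫ x in bin h b j, ∏ i, φ i (x i - binCenter h b j i) =
      ∏ i, ∫ y in (-(h / 2))..(h / 2), φ i y := by
  rw [bin, volume_pi, Measure.restrict_pi_pi,
    integral_fintype_prod_eq_prod (f := fun i y => φ i (y - binCenter h b j i))]
  refine Finset.prod_congr rfl fun l _ => ?_
  rw [integral_Ico_eq_integral_Ioc, ← intervalIntegral.integral_of_le (by nlinarith),
    intervalIntegral.integral_comp_sub_right (fun y => φ l y)]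
  congr 1 <;> · rw [binCenter]; ring

/-- The factor `1 / 12` of the bias comes from `∫ y² = h³ / 12` over `[-h/2, h/2]`; mixed moments
vanish because `y` is odd. Both integrands are products over the coordinates, with factor `1` in the
coordinates not involved. -/
theorem setIntegral_bin_center_mul (hh : 0 < h) (j : Fin d → ℤ) (i k : Fin d) :
    ∫ x in bin h b j, (x i - binCenter h b j i) * (x k - binCenter h b j k) =
      if i = k then h ^ d * (h ^ 2 / 12) else 0 := by
  by_cases hik : i = k
  · subst hik
    have := setIntegral_bin_prod_center (b := b) hh (fun l y => if l = i then y * y else 1) j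
    simp only [Finset.prod_ite_eq', Finset.mem_univ, if_true] at this
    rw [this, ← Finset.mul_prod_erase _ _ (Finset.mem_univ i), if_pos rfl]
    have h1 : ∏ x ∈ Finset.univ.erase i, (∫ y in (-(h / 2))..(h / 2), if x = i then y * y else 1)
        = h ^ (d - 1) := by
      rw [Finset.prod_congr rfl (g := fun _ => h)]
      · simp
      · intro x hx
        simp [Finset.ne_of_mem_erase hx]
    have h2 : ∫ y in (-(h / 2))..(h / 2), y * y = h ^ 3 / 12 := by
      simp only [← pow_two, integral_pow]
      ring
    have h3 : h ^ d = h * h ^ (d - 1) := by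
      rw [← pow_succ', Nat.sub_add_cancel (Fin.pos i)]
    rw [h1, h3]
    simp only [if_true, h2]
    ring
  · have := setIntegral_bin_prod_center (b := b) hh
      (fun l y => (if l = i then y else 1) * (if l = k then y else 1)) j
    simp only [Finset.prod_mul_distrib, Finset.prod_ite_eq', Finset.mem_univ, if_true] at this
    rw [this, if_neg hik]
    refine Finset.prod_eq_zero (Finset.mem_univ i) ?_
    simp [hik]

theorem setIntegral_bin_linear_sq (hh : 0 < h) (j : Fin d → ℤ) (m : Fin d → ℝ) :
    ∫ x in bin h b j, (∑ i, m i * (x i - binCenter h b j i)) ^ 2 =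
      h ^ d * (h ^ 2 / 12) * ∑ i, m i ^ 2 := by
  have h1 : ∀ x : Fin d → ℝ, (∑ i, m i * (x i - binCenter h b j i)) ^ 2 =
      ∑ i, ∑ k, m i * m k * ((x i - binCenter h b j i) * (x k - binCenter h b j k)) := by
    intro x
    rw [pow_two, Finset.sum_mul_sum]
    refine Finset.sum_congr rfl fun i _ => Finset.sum_congr rfl fun k _ => by ring
  simp only [h1]
  rw [integral_finsetSum _ fun i _ => integrableOn_bin (by fun_prop) j, Finset.mul_sum]
  refine Finset.sum_congr rfl fun i _ => ?_
  rw [integral_finsetSum _ fun i _ => integrableOn_bin (by fun_prop) j]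
  simp only [integral_const_mul, setIntegral_bin_center_mul hh]
  simp
  ring

end Bins

/-! ### Integrated squared bias: Poincaré inequality and linear approximation on the bins -/

section Bias

variable {d : ℕ} {h : ℝ} {b : Fin d → ℝ}

theorem sq_intervalIntegral_le {φ : ℝ → ℝ} (hφ : Continuous φ) :
    (∫ t in (0 : ℝ)..1, φ t) ^ 2 ≤ ∫ t in (0 : ℝ)..1, φ t ^ 2 := by
  set a := ∫ t in (0 : ℝ)..1, φ t with ha
  have h0 : 0 ≤ ∫ t in (0 : ℝ)..1, (φ t - a) ^ 2 :=
    intervalIntegral.integral_nonneg zero_le_one fun t _ => sq_nonneg _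
  have h1 : ∀ t, (φ t - a) ^ 2 = (φ t ^ 2 - 2 * a * φ t) + a ^ 2 := fun t => by ring
  simp only [h1] at h0
  rw [intervalIntegral.integral_add, intervalIntegral.integral_sub,
    intervalIntegral.integral_const_mul, ← ha] at h0
  · simp at h0
    nlinarith
  all_goals exact Continuous.intervalIntegrable (by fun_prop) _ _

/-- The squared Euclidean norm of the gradient. -/
noncomputable def gradSq (r : (Fin d → ℝ) → ℝ) (x : Fin d → ℝ) : ℝ :=
  ∑ i, (fderiv ℝ r x (Pi.single i 1)) ^ 2

theorem continuous_partialDeriv {r : (Fin d → ℝ) → ℝ} (hr : ContDiff ℝ 1 r) (i : Fin d) :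
    Continuous fun x => fderiv ℝ r x (Pi.single i 1) :=
  (hr.continuous_fderiv one_ne_zero).clm_apply continuous_const

theorem continuous_gradSq {r : (Fin d → ℝ) → ℝ} (hr : ContDiff ℝ 1 r) :
    Continuous (gradSq r) :=
  continuous_finsetSum _ fun i _ => (continuous_partialDeriv hr i).pow 2

theorem gradSq_nonneg (r : (Fin d → ℝ) → ℝ) (x : Fin d → ℝ) : 0 ≤ gradSq r x :=
  Finset.sum_nonneg fun _ _ => sq_nonneg _

theorem sq_fderiv_apply_le (r : (Fin d → ℝ) → ℝ) (z v : Fin d → ℝ) (hv : ∀ i, |v i| ≤ h) :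
    (fderiv ℝ r z v) ^ 2 ≤ d * h ^ 2 * gradSq r z := by
  have h1 : fderiv ℝ r z v = ∑ i, v i * fderiv ℝ r z (Pi.single i 1) := by
    conv_lhs => rw [← Finset.univ_sum_single v, map_sum]
    refine Finset.sum_congr rfl fun i _ => ?_
    rw [← smul_eq_mul, ← map_smul, ← Pi.single_smul, smul_eq_mul, mul_one]
  rw [h1]
  refine (Finset.sum_mul_sq_le_sq_mul_sq _ _ _).trans ?_
  refine mul_le_mul_of_nonneg_right ?_ (gradSq_nonneg r z)
  calc ∑ i, v i ^ 2 ≤ ∑ _i : Fin d, h ^ 2 :=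
        Finset.sum_le_sum fun i _ => sq_le_sq' (abs_le.1 (hv i)).1 (abs_le.1 (hv i)).2
    _ = d * h ^ 2 := by simp

/-- The increment is the integral of the directional derivative along the segment. Jensen moves the
square inside, and Cauchy–Schwarz with `∑ (y i - x i) ^ 2 ≤ d h ^ 2` bounds the integrand. -/
theorem sq_sub_le_integral_gradSq {r : (Fin d → ℝ) → ℝ} (hr : ContDiff ℝ 1 r)
    (x y : Fin d → ℝ) (hxy : ∀ i, |y i - x i| ≤ h) :
    (r y - r x) ^ 2 ≤ d * h ^ 2 * ∫ t in (0 : ℝ)..1, gradSq r (x + t • (y - x)) := by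
  have hc : Continuous fun t : ℝ => fderiv ℝ r (x + t • (y - x)) (y - x) :=
    ((hr.continuous_fderiv one_ne_zero).comp (by fun_prop)).clm_apply continuous_const
  have h1 : ∫ t in (0 : ℝ)..1, fderiv ℝ r (x + t • (y - x)) (y - x) = r y - r x := by
    have := intervalIntegral.integral_eq_sub_of_hasDerivAt (a := 0) (b := 1)
      (f := fun t : ℝ => r (x + t • (y - x)))
      (f' := fun t : ℝ => fderiv ℝ r (x + t • (y - x)) (y - x)) (fun t _ => ?_)
      (hc.intervalIntegrable _ _)
    · simpa using this
    · have h2 : HasDerivAt (fun t : ℝ => x + t • (y - x)) (y - x) t := by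
        simpa using ((hasDerivAt_id t).smul_const (y - x)).const_add x
      exact ((hr.differentiable one_ne_zero _).hasFDerivAt).comp_hasDerivAt t h2
  rw [← h1, ← intervalIntegral.integral_const_mul]
  refine (sq_intervalIntegral_le hc).trans ?_
  refine intervalIntegral.integral_mono_on zero_le_one ((hc.pow 2).intervalIntegrable _ _)
    (Continuous.intervalIntegrable ?_ _ _) fun t _ => sq_fderiv_apply_le r _ _ hxy
  exact continuous_const.mul ((continuous_gradSq hr).comp (by fun_prop))

/-- With `v = y - x`, which ranges in the cube `[-h, h]^d`, and with `x` released to the whole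
space, translation invariance removes `t • v`. This costs only the volume `(2 h) ^ d` of the cube
and avoids the Jacobian of `x ↦ x + t • (y - x)`. -/
theorem lintegral_segment_le (hh : 0 < h) {ψ : (Fin d → ℝ) → ℝ≥0∞} (hψ : Measurable ψ)
    (j : Fin d → ℤ) :
    ∫⁻ x in bin h b j, ∫⁻ y in bin h b j, ∫⁻ t in Set.Ioc (0 : ℝ) 1, ψ (x + t • (y - x)) ≤
      ENNReal.ofReal ((2 * h) ^ d) * ∫⁻ x, ψ x := by
  set B : Set (Fin d → ℝ) := Set.Icc (fun _ => -h) (fun _ => h) with hB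
  have hBm : MeasurableSet B := measurableSet_Icc
  have hBv : volume B = ENNReal.ofReal ((2 * h) ^ d) := by
    rw [hB, Real.volume_Icc_pi]
    simp only [sub_neg_eq_add, Finset.prod_const, Finset.card_univ, Fintype.card_fin, ← two_mul]
    rw [ENNReal.ofReal_pow (by positivity)]
  have h1 : ∀ x ∈ bin h b j,
      ∫⁻ y in bin h b j, ∫⁻ t in Set.Ioc (0 : ℝ) 1, ψ (x + t • (y - x)) ≤
        ∫⁻ v in B, ∫⁻ t in Set.Ioc (0 : ℝ) 1, ψ (x + t • v) := by
    intro x hx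
    rw [← lintegral_indicator (measurableSet_bin j), ← lintegral_indicator hBm,
      ← lintegral_sub_right_eq_self
        (B.indicator fun v => ∫⁻ t in Set.Ioc (0 : ℝ) 1, ψ (x + t • v)) x]
    refine lintegral_mono fun y => ?_
    by_cases hy : y ∈ bin h b j
    · have hyx : y - x ∈ B :=
        ⟨fun i => (abs_le.1 (abs_sub_le_of_mem_bin hy hx i)).1,
          fun i => (abs_le.1 (abs_sub_le_of_mem_bin hy hx i)).2⟩
      simp [hy, hyx]
    · simp [hy]
  have hm2 : Measurable fun p : (Fin d → ℝ) × (Fin d → ℝ) =>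
      ∫⁻ t in Set.Ioc (0 : ℝ) 1, ψ (p.1 + t • p.2) :=
    Measurable.lintegral_prod_right' (f := fun q : ((Fin d → ℝ) × (Fin d → ℝ)) × ℝ =>
      ψ (q.1.1 + q.2 • q.1.2)) (hψ.comp (by fun_prop))
  calc _ ≤ ∫⁻ x in bin h b j, ∫⁻ v in B, ∫⁻ t in Set.Ioc (0 : ℝ) 1, ψ (x + t • v) :=
        setLIntegral_mono' (measurableSet_bin j) h1
    _ ≤ ∫⁻ x, ∫⁻ v in B, ∫⁻ t in Set.Ioc (0 : ℝ) 1, ψ (x + t • v) := setLIntegral_le_lintegral _ _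
    _ = ∫⁻ v in B, ∫⁻ x, ∫⁻ t in Set.Ioc (0 : ℝ) 1, ψ (x + t • v) :=
        lintegral_lintegral_swap hm2.aemeasurable
    _ = ∫⁻ v in B, ∫⁻ x, ψ x := by
        refine lintegral_congr fun v => ?_
        have hv : Measurable fun p : (Fin d → ℝ) × ℝ => ψ (p.1 + p.2 • v) :=
          hψ.comp (by fun_prop)
        rw [lintegral_lintegral_swap hv.aemeasurable]
        simp only [lintegral_add_right_eq_self ψ]
        simp
    _ = _ := by rw [setLIntegral_const, hBv, mul_comm]

/-- A Poincaré inequality on the cubes of a grid. -/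
theorem setIntegral_bin_sub_average_sq_le_gradSq (hh : 0 < h) {r : (Fin d → ℝ) → ℝ}
    (hr : ContDiff ℝ 1 r) (j : Fin d → ℤ) :
    ∫ x in bin h b j, (r x - binAverage h b j r) ^ 2 ≤
      d * 2 ^ d * h ^ 2 * ∫ x in bin h b j, gradSq r x := by
  have hrc := hr.continuous
  set Q := bin h b j with hQ
  have hQm : MeasurableSet Q := measurableSet_bin j
  -- Cutting the gradient off outside the bin loses nothing, since segments stay inside by
  -- convexity, and keeps the final integral local.
  set ψ : (Fin d → ℝ) → ℝ≥0∞ := Q.indicator fun x => ENNReal.ofReal (gradSq r x) with hψ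
  have hψm : Measurable ψ :=
    (continuous_gradSq hr).measurable.ennreal_ofReal.indicator hQm
  have hG : 0 ≤ ∫ x in Q, gradSq r x := integral_nonneg fun x => gradSq_nonneg r x
  have h1 : ∀ x ∈ Q, ∀ y ∈ Q, ENNReal.ofReal ((r y - r x) ^ 2) ≤ ENNReal.ofReal (d * h ^ 2) *
      ∫⁻ t in Set.Ioc (0 : ℝ) 1, ψ (x + t • (y - x)) := by
    intro x hx y hy
    refine (ENNReal.ofReal_le_ofReal (sq_sub_le_integral_gradSq hr x y
      (abs_sub_le_of_mem_bin hy hx))).trans ?_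
    rw [ENNReal.ofReal_mul (by positivity), intervalIntegral.integral_of_le zero_le_one,
      ofReal_integral_eq_lintegral_ofReal]
    · refine mul_le_mul' le_rfl (setLIntegral_mono' measurableSet_Ioc fun t ht => ?_)
      have : x + t • (y - x) ∈ Q := (convex_bin j).add_smul_sub_mem hx hy ⟨ht.1.le, ht.2⟩
      simp [hψ, this]
    · have hc : Continuous fun t : ℝ => gradSq r (x + t • (y - x)) :=
        (continuous_gradSq hr).comp (by fun_prop)
      exact hc.integrableOn_Icc.mono_set Set.Ioc_subset_Icc_self
    · exact ae_of_all _ fun t => gradSq_nonneg r _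
  -- For each `x` in the bin, `r x` is a worse constant than the average; integrating over `x`
  -- produces the factor `h ^ d`. Against the `(2 * h) ^ d` on the right, it leaves `2 ^ d`.
  have h2 : ENNReal.ofReal (h ^ d) *
      ENNReal.ofReal (∫ x in Q, (r x - binAverage h b j r) ^ 2) ≤
        ENNReal.ofReal (d * h ^ 2) * (ENNReal.ofReal ((2 * h) ^ d) * ∫⁻ x, ψ x) := by
    calc _ = ∫⁻ _x in Q, ENNReal.ofReal (∫ y in Q, (r y - binAverage h b j r) ^ 2) := by
          rw [setLIntegral_const, hQ, volume_bin hh, mul_comm]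
      _ ≤ ∫⁻ x in Q, ∫⁻ y in Q, ENNReal.ofReal ((r y - r x) ^ 2) := by
          refine lintegral_mono fun x => ?_
          rw [← ofReal_integral_eq_lintegral_ofReal (integrableOn_bin (by fun_prop) j)
            (ae_of_all _ fun y => sq_nonneg _)]
          exact ENNReal.ofReal_le_ofReal (setIntegral_bin_sub_average_sq_le hh hrc j _)
      _ ≤ ∫⁻ x in Q, ∫⁻ y in Q, ENNReal.ofReal (d * h ^ 2) *
            ∫⁻ t in Set.Ioc (0 : ℝ) 1, ψ (x + t • (y - x)) :=
          setLIntegral_mono' hQm fun x hx => setLIntegral_mono' hQm fun y hy => h1 x hx y hy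
      _ = ENNReal.ofReal (d * h ^ 2) * ∫⁻ x in Q, ∫⁻ y in Q,
            ∫⁻ t in Set.Ioc (0 : ℝ) 1, ψ (x + t • (y - x)) := by
          simp_rw [lintegral_const_mul' _ _ ENNReal.ofReal_ne_top]
      _ ≤ _ := by
          gcongr
          exact lintegral_segment_le hh hψm j
  have h3 : ∫⁻ x, ψ x = ENNReal.ofReal (∫ x in Q, gradSq r x) := by
    rw [hψ, lintegral_indicator hQm, ofReal_integral_eq_lintegral_ofReal
      (integrableOn_bin (continuous_gradSq hr) j) (ae_of_all _ fun y => gradSq_nonneg r y)]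
  rw [h3, ← ENNReal.ofReal_mul (by positivity), ← ENNReal.ofReal_mul (by positivity),
    ← ENNReal.ofReal_mul (by positivity), ENNReal.ofReal_le_ofReal_iff (by positivity),
    mul_pow] at h2
  have hd : 0 < h ^ d := by positivity
  refine le_of_mul_le_mul_left (h2.trans_eq ?_) hd
  ring

/-- Young's inequality with parameter `ε` separates the linear part, whose constant `1 / 12` must be
kept almost intact, from the remainder `r`, whose gradient is the deviation of `∇ f` from its bin
average. A crude Poincaré constant suffices there. -/
theorem setIntegral_bin_sub_average_sq_le_split (hh : 0 < h) {f : (Fin d → ℝ) → ℝ}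
    (hf : ContDiff ℝ 1 f) (j : Fin d → ℤ) {ε : ℝ} (hε : 0 < ε) :
    ∫ x in bin h b j, (f x - binAverage h b j f) ^ 2 ≤
      (1 + ε) * (h ^ 2 / 12) * (∑ i, ∫ x in bin h b j, (fderiv ℝ f x (Pi.single i 1)) ^ 2) +
      (1 + 1 / ε) * (d * 2 ^ d * h ^ 2) * ∑ i, ∫ x in bin h b j,
        (fderiv ℝ f x (Pi.single i 1) -
          binAverage h b j fun y => fderiv ℝ f y (Pi.single i 1)) ^ 2 := by
  set m : Fin d → ℝ := fun i => binAverage h b j fun y => fderiv ℝ f y (Pi.single i 1) with hm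
  set ℓ : (Fin d → ℝ) → ℝ := fun x => ∑ i, m i * (x i - binCenter h b j i) with hℓ
  have hℓc : ContDiff ℝ 1 ℓ := by fun_prop
  set r : (Fin d → ℝ) → ℝ := fun x => f x - ℓ x with hr
  have hrc : ContDiff ℝ 1 r := hf.sub hℓc
  have hder : ∀ x i, fderiv ℝ ℓ x (Pi.single i 1) = m i := by
    intro x i
    have h1 : HasFDerivAt ℓ (∑ k, m k • ContinuousLinearMap.proj (R := ℝ) (φ := fun _ => ℝ) k) x :=
      HasFDerivAt.fun_sum fun k _ =>
        ((ContinuousLinearMap.proj (R := ℝ) (φ := fun _ => ℝ) k).hasFDerivAt.sub_const _).const_mul _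
    rw [h1.fderiv]
    simp [Pi.single_apply]
  have hgrad : ∀ x, gradSq r x = ∑ i, (fderiv ℝ f x (Pi.single i 1) - m i) ^ 2 := by
    intro x
    refine Finset.sum_congr rfl fun i _ => ?_
    rw [hr, fderiv_fun_sub (hf.differentiable one_ne_zero x) (hℓc.differentiable one_ne_zero x),
      sub_apply, hder]
  have hP := setIntegral_bin_sub_average_sq_le_gradSq (b := b) hh hrc j
  have hDc : ∀ i, Continuous fun x => fderiv ℝ f x (Pi.single i 1) :=
    continuous_partialDeriv hf
  simp only [hgrad] at hP
  rw [integral_finsetSum _ fun i _ => integrableOn_bin (by fun_prop) j] at hP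
  have hL : ∫ x in bin h b j, ℓ x ^ 2 ≤
      h ^ 2 / 12 * ∑ i, ∫ x in bin h b j, (fderiv ℝ f x (Pi.single i 1)) ^ 2 := by
    rw [hℓ, setIntegral_bin_linear_sq hh, mul_comm (h ^ d), mul_assoc, Finset.mul_sum]
    gcongr with i
    exact binAverage_sq_le hh (continuous_partialDeriv hf i) j
  have hfc := hf.continuous
  have hlc := hℓc.continuous
  have hrc' := hrc.continuous
  have hpt : ∀ x, (f x - binAverage h b j r) ^ 2 ≤
      (1 + ε) * ℓ x ^ 2 + (1 + 1 / ε) * (r x - binAverage h b j r) ^ 2 := by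
    intro x
    have h1 : f x - binAverage h b j r = ℓ x + (r x - binAverage h b j r) := by
      simp only [hr]; ring
    rw [h1]
    generalize r x - binAverage h b j r = q
    have h2 : (1 + ε) * ℓ x ^ 2 + (1 + 1 / ε) * q ^ 2 - (ℓ x + q) ^ 2 =
        (ε * ℓ x - q) ^ 2 / ε := by
      field_simp
      ring
    have h3 : 0 ≤ (ε * ℓ x - q) ^ 2 / ε := by positivity
    linarith
  -- The average of `r` is admissible as a competitor to that of `f`, so the two need not be shown
  -- equal.
  calc _ ≤ ∫ x in bin h b j, (f x - binAverage h b j r) ^ 2 :=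
        setIntegral_bin_sub_average_sq_le hh hfc j _
    _ ≤ ∫ x in bin h b j, ((1 + ε) * ℓ x ^ 2 + (1 + 1 / ε) * (r x - binAverage h b j r) ^ 2) :=
        integral_mono (integrableOn_bin (by fun_prop) j) (integrableOn_bin (by fun_prop) j) hpt
    _ = (1 + ε) * (∫ x in bin h b j, ℓ x ^ 2) +
          (1 + 1 / ε) * ∫ x in bin h b j, (r x - binAverage h b j r) ^ 2 := by
        rw [integral_add (integrableOn_bin (by fun_prop) j) (integrableOn_bin (by fun_prop) j),
          integral_const_mul, integral_const_mul]
    _ ≤ _ := by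
        rw [mul_assoc (1 + ε), mul_assoc (1 + 1 / ε)]
        gcongr

/-- Far away the `L²` mass of `G` is small; on a compact set `G` is uniformly continuous. Neither
fact refers to the grid, which is why the threshold on `h` is uniform in `b`. -/
theorem exists_tsum_bin_sub_average_sq_le {G : (Fin d → ℝ) → ℝ} (hG : Continuous G)
    (hG2 : Integrable fun x => G x ^ 2) {ε : ℝ} (hε : 0 < ε) :
    ∃ h₁ > 0, ∀ h, 0 < h → h < h₁ → ∀ b : Fin d → ℝ,
      ∑' j, ENNReal.ofReal (∫ x in bin h b j, (G x - binAverage h b j G) ^ 2) ≤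
        ENNReal.ofReal ε := by
  obtain ⟨R, hR⟩ : ∃ R : ℕ, ∫ x in (Metric.closedBall (0 : Fin d → ℝ) R)ᶜ, G x ^ 2 < ε / 2 := by
    have h1 := tendsto_setIntegral_of_antitone (μ := (volume : Measure (Fin d → ℝ)))
      (f := fun x => G x ^ 2) (s := fun n : ℕ => (Metric.closedBall (0 : Fin d → ℝ) n)ᶜ)
      (fun n => Metric.isClosed_closedBall.measurableSet.compl)
      (fun n m hnm => Set.compl_subset_compl.2
        (Metric.closedBall_subset_closedBall (by exact_mod_cast hnm))) ⟨0, hG2.integrableOn⟩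
    have h2 : ⋂ n : ℕ, (Metric.closedBall (0 : Fin d → ℝ) n)ᶜ = ∅ := by
      rw [← Set.compl_iUnion, Metric.iUnion_closedBall_nat, Set.compl_univ]
    rw [h2, Measure.restrict_empty, integral_zero_measure] at h1
    exact (h1.eventually (gt_mem_nhds (half_pos hε))).exists
  set K := Metric.closedBall (0 : Fin d → ℝ) (R + 1) with hK
  have hKc : IsCompact K := isCompact_closedBall _ _
  obtain ⟨η, hη, hηK⟩ : ∃ η > 0, η ^ 2 * volume.real K ≤ ε / 2 := by
    refine ⟨Real.sqrt (ε / 2 / (volume.real K + 1)), by positivity, ?_⟩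
    rw [Real.sq_sqrt (by positivity), div_mul_eq_mul_div, div_le_iff₀ (by positivity)]
    nlinarith [measureReal_nonneg (μ := volume) (s := K)]
  obtain ⟨δ, hδ, hδG⟩ := Metric.uniformContinuousOn_iff.1
    (hKc.uniformContinuousOn_of_continuous hG.continuousOn) η hη
  refine ⟨min δ 1, by positivity, fun h hh hh1 b => ?_⟩
  have hhδ := hh1.trans_le (min_le_left _ _)
  have hh1' := hh1.trans_le (min_le_right _ _)
  set B := Metric.closedBall (0 : Fin d → ℝ) R with hB
  have hBm : MeasurableSet Bᶜ := Metric.isClosed_closedBall.measurableSet.compl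
  have hKm : MeasurableSet K := Metric.isClosed_closedBall.measurableSet
  set Φ : (Fin d → ℝ) → ℝ≥0∞ := fun x => Bᶜ.indicator (fun x => ENNReal.ofReal (G x ^ 2)) x +
    K.indicator (fun _ => ENNReal.ofReal (η ^ 2)) x with hΦ
  have hbin : ∀ j, ENNReal.ofReal (∫ x in bin h b j, (G x - binAverage h b j G) ^ 2) ≤
      ∫⁻ x in bin h b j, Φ x := by
    intro j
    -- A bin outside the ball is compared with the constant `0`. A bin that meets it lies in `K`,
    -- since `h < 1`, and is compared with a value of `G` in it.
    by_cases hj : bin h b j ⊆ Bᶜ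
    · have h1 := setIntegral_bin_sub_average_sq_le (b := b) hh hG j 0
      refine (ENNReal.ofReal_le_ofReal h1).trans ?_
      rw [ofReal_integral_eq_lintegral_ofReal (integrableOn_bin (by fun_prop) j)
        (ae_of_all _ fun y => sq_nonneg _)]
      refine setLIntegral_mono' (measurableSet_bin j) fun x hx => ?_
      simp [hΦ, Set.indicator_of_mem (hj hx)]
    · obtain ⟨x₀, hx₀, hx₀B⟩ := Set.not_subset.1 hj
      rw [Set.notMem_compl_iff] at hx₀B
      have hd : ∀ x ∈ bin h b j, dist x x₀ ≤ h := fun x hx =>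
        (dist_pi_le_iff hh.le).2 fun i => by
          rw [Real.dist_eq]; exact abs_sub_le_of_mem_bin hx hx₀ i
      have hK' : ∀ x ∈ bin h b j, x ∈ K := by
        intro x hx
        rw [hK, Metric.mem_closedBall]
        have := dist_triangle x x₀ 0
        have h2 := hd x hx
        rw [hB, Metric.mem_closedBall] at hx₀B
        linarith
      have h1 := setIntegral_bin_sub_average_sq_le (b := b) hh hG j (G x₀)
      refine (ENNReal.ofReal_le_ofReal h1).trans ?_
      rw [ofReal_integral_eq_lintegral_ofReal (integrableOn_bin (by fun_prop) j)
        (ae_of_all _ fun y => sq_nonneg _)]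
      refine setLIntegral_mono' (measurableSet_bin j) fun x hx => ?_
      have h3 := hδG x (hK' x hx) x₀ (hK' x₀ hx₀) ((hd x hx).trans_lt hhδ)
      rw [Real.dist_eq] at h3
      simp only [hΦ, Set.indicator_of_mem (hK' x hx)]
      refine le_add_left (ENNReal.ofReal_le_ofReal ?_)
      exact sq_le_sq' (abs_le.1 h3.le).1 (abs_le.1 h3.le).2
  refine (ENNReal.tsum_le_tsum hbin).trans ?_
  rw [← lintegral_eq_tsum_bin hh b volume, hΦ,
    lintegral_add_right _ (measurable_const.indicator hKm), lintegral_indicator hBm,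
    lintegral_indicator hKm, setLIntegral_const, ← ofReal_integral_eq_lintegral_ofReal
      hG2.integrableOn (ae_of_all _ fun y => sq_nonneg _),
    ← ofReal_measureReal hKc.measure_lt_top.ne, ← ENNReal.ofReal_mul (by positivity),
    ← ENNReal.ofReal_add (integral_nonneg fun x => sq_nonneg _) (by positivity)]
  exact ENNReal.ofReal_le_ofReal (by linarith)

/-- The integrated squared bias of the histogram is at most `h ^ 2 (R_d(f') / 12 + o(1))`. -/
theorem exists_tsum_bin_bias_le {f : (Fin d → ℝ) → ℝ} (hf : BiasAssumption f) {ε : ℝ}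
    (hε : 0 < ε) :
    ∃ h₁ > 0, ∀ h, 0 < h → h < h₁ → ∀ b : Fin d → ℝ,
      ∑' j, ENNReal.ofReal (∫ x in bin h b j, (f x - binAverage h b j f) ^ 2) ≤
        ENNReal.ofReal (h ^ 2 * (roughness f / 12 + ε)) := by
  have hf1 : ContDiff ℝ 1 f := hf.contDiff.of_le (by norm_num)
  have hR : 0 ≤ roughness f := Finset.sum_nonneg fun i _ => integral_nonneg fun x => sq_nonneg _
  -- `e` makes the excess `e * roughness f / 12` at most `ε / 2`; `e'` below does the same for the
  -- remainder term.
  set e : ℝ := 6 * ε / (roughness f + 1) with he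
  have he0 : 0 < e := by positivity
  set A : ℝ := (1 + 1 / e) * (d * 2 ^ d) with hA
  have hA0 : 0 ≤ A := by positivity
  set e' : ℝ := ε / 2 / ((A + 1) * (d + 1)) with he'
  have he'0 : 0 < e' := by positivity
  choose H hH0 hH using fun i => exists_tsum_bin_sub_average_sq_le
    (continuous_partialDeriv hf1 i) (hf.sq_integrable i) he'0
  obtain ⟨h₁, hh₁, hle⟩ : ∃ h₁ > 0, ∀ i, h₁ ≤ H i := by
    rcases isEmpty_or_nonempty (Fin d) with hd | hd
    · exact ⟨1, one_pos, fun i => (hd.false i).elim⟩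
    · obtain ⟨i, hi⟩ := Finite.exists_min H
      exact ⟨H i, hH0 i, hi⟩
  refine ⟨h₁, hh₁, fun h hh hhh b => ?_⟩
  have hsum1 : ∀ i : Fin d, ∑' j, ENNReal.ofReal
      (∫ x in bin h b j, (fderiv ℝ f x (Pi.single i 1)) ^ 2) =
        ENNReal.ofReal (∫ x, (fderiv ℝ f x (Pi.single i 1)) ^ 2) := by
    intro i
    rw [ofReal_integral_eq_lintegral_ofReal (hf.sq_integrable i)
      (ae_of_all _ fun y => sq_nonneg _), lintegral_eq_tsum_bin hh b]
    refine tsum_congr fun j => ofReal_integral_eq_lintegral_ofReal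
      (hf.sq_integrable i).integrableOn (ae_of_all _ fun y => sq_nonneg _)
  have hn1 : ∀ j (i : Fin d), 0 ≤ ∫ x in bin h b j, (fderiv ℝ f x (Pi.single i 1)) ^ 2 :=
    fun j i => integral_nonneg fun x => sq_nonneg _
  have hn2 : ∀ j (i : Fin d), 0 ≤ ∫ x in bin h b j, (fderiv ℝ f x (Pi.single i 1) -
      binAverage h b j fun y => fderiv ℝ f y (Pi.single i 1)) ^ 2 :=
    fun j i => integral_nonneg fun x => sq_nonneg _
  calc _ ≤ ∑' j, (ENNReal.ofReal ((1 + e) * (h ^ 2 / 12)) *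
          (∑ i, ENNReal.ofReal (∫ x in bin h b j, (fderiv ℝ f x (Pi.single i 1)) ^ 2)) +
        ENNReal.ofReal (A * h ^ 2) * ∑ i, ENNReal.ofReal (∫ x in bin h b j,
          (fderiv ℝ f x (Pi.single i 1) -
            binAverage h b j fun y => fderiv ℝ f y (Pi.single i 1)) ^ 2)) := by
        refine ENNReal.tsum_le_tsum fun j => ?_
        refine (ENNReal.ofReal_le_ofReal
          (setIntegral_bin_sub_average_sq_le_split hh hf1 j he0)).trans_eq ?_
        rw [← ENNReal.ofReal_sum_of_nonneg fun i _ => hn1 j i,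
          ← ENNReal.ofReal_sum_of_nonneg fun i _ => hn2 j i,
          ← ENNReal.ofReal_mul (by positivity), ← ENNReal.ofReal_mul (by positivity),
          ← ENNReal.ofReal_add
            (mul_nonneg (by positivity) (Finset.sum_nonneg fun i _ => hn1 j i))
            (mul_nonneg (by positivity) (Finset.sum_nonneg fun i _ => hn2 j i)), hA]
        congr 2
        ring
    _ = ENNReal.ofReal ((1 + e) * (h ^ 2 / 12)) *
          (∑ i, ENNReal.ofReal (∫ x, (fderiv ℝ f x (Pi.single i 1)) ^ 2)) +
        ENNReal.ofReal (A * h ^ 2) * ∑ i : Fin d, ∑' j, ENNReal.ofReal (∫ x in bin h b j,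
          (fderiv ℝ f x (Pi.single i 1) -
            binAverage h b j fun y => fderiv ℝ f y (Pi.single i 1)) ^ 2) := by
        rw [ENNReal.tsum_add, ENNReal.tsum_mul_left, ENNReal.tsum_mul_left,
          Summable.tsum_finsetSum fun _ _ => ENNReal.summable,
          Summable.tsum_finsetSum fun _ _ => ENNReal.summable]
        simp only [hsum1]
    _ ≤ ENNReal.ofReal ((1 + e) * (h ^ 2 / 12)) * ENNReal.ofReal (roughness f) +
        ENNReal.ofReal (A * h ^ 2) * ∑ _i : Fin d, ENNReal.ofReal e' := by
        rw [roughness, ENNReal.ofReal_sum_of_nonneg fun i _ => integral_nonneg fun x => sq_nonneg _]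
        gcongr with i
        exact hH i h hh (hhh.trans_le (hle i)) b
    _ = ENNReal.ofReal (h ^ 2 * ((1 + e) / 12 * roughness f + A * (d * e'))) := by
        rw [Finset.sum_const, Finset.card_univ, Fintype.card_fin, nsmul_eq_mul,
          ← ENNReal.ofReal_natCast d, ← ENNReal.ofReal_mul (by positivity),
          ← ENNReal.ofReal_mul (by positivity), ← ENNReal.ofReal_mul (by positivity),
          ← ENNReal.ofReal_add (by positivity) (by positivity)]
        congr 1
        ring
    _ ≤ _ := by
        refine ENNReal.ofReal_le_ofReal (mul_le_mul_of_nonneg_left ?_ (sq_nonneg h))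
        have h1 : e * roughness f ≤ 6 * ε := by
          rw [he, div_mul_eq_mul_div, div_le_iff₀ (by positivity)]
          nlinarith
        have h2 : A * (d * e') ≤ ε / 2 := by
          have : A * (d * e') = (A * d) * (ε / 2) / ((A + 1) * (d + 1)) := by
            rw [he']; ring
          rw [this, div_le_iff₀ (by positivity)]
          have h3 : A * d ≤ (A + 1) * (d + 1) := by
            have : (0 : ℝ) ≤ d := by positivity
            nlinarith
          nlinarith
        nlinarith

end Bias

/-! ### Covariances of bin indicators at two fixed times, summed over the bins -/

section Covariance

variable {Ω : Type*} {mΩ : MeasurableSpace Ω} {P : Measure Ω}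

/-- The covariance of the indicators of two events. -/
noncomputable def eventCov (P : Measure Ω) (A B : Set Ω) : ℝ :=
  P.real (A ∩ B) - P.real A * P.real B

theorem eventCov_comm (A B : Set Ω) : eventCov P A B = eventCov P B A := by
  rw [eventCov, eventCov, Set.inter_comm, mul_comm]

/-- The sum over the bins in `J` of the covariances of the indicators of `X s` and `X r` being in
the bin. -/
noncomputable def binCov (P : Measure Ω) {d : ℕ} (X : ℝ → Ω → (Fin d → ℝ)) (h : ℝ)
    (b : Fin d → ℝ) (J : Finset (Fin d → ℤ)) (s r : ℝ) : ℝ :=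
  ∑ j ∈ J, eventCov P (X s ⁻¹' bin h b j) (X r ⁻¹' bin h b j)

theorem binCov_comm {d : ℕ} (X : ℝ → Ω → (Fin d → ℝ)) (h : ℝ) (b : Fin d → ℝ) (J : Finset (Fin d → ℤ)) (s r : ℝ) :
    binCov P X h b J s r = binCov P X h b J r s :=
  Finset.sum_congr rfl fun _ _ => eventCov_comm _ _

variable [IsProbabilityMeasure P]

theorem eventCov_union_right {A B B' : Set Ω} (hA : MeasurableSet A) (hB' : MeasurableSet B')
    (hd : Disjoint B B') : eventCov P A (B ∪ B') = eventCov P A B + eventCov P A B' := by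
  rw [eventCov, eventCov, eventCov, Set.inter_union_distrib_left, measureReal_union hd hB',
    measureReal_union (hd.mono Set.inter_subset_right Set.inter_subset_right) (hA.inter hB')]
  ring

theorem eventCov_union_left {A A' B : Set Ω} (hA' : MeasurableSet A') (hB : MeasurableSet B)
    (hd : Disjoint A A') : eventCov P (A ∪ A') B = eventCov P A B + eventCov P A' B := by
  rw [eventCov_comm, eventCov_union_right hB hA' hd, eventCov_comm B, eventCov_comm B]

theorem eventCov_le_real (A B : Set Ω) : eventCov P A B ≤ P.real A := by
  have h1 : P.real (A ∩ B) ≤ P.real A := measureReal_mono Set.inter_subset_left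
  have h2 : 0 ≤ P.real A * P.real B := by positivity
  rw [eventCov]
  linarith

theorem abs_eventCov_le_one (A B : Set Ω) : |eventCov P A B| ≤ 1 := by
  have h1 : P.real (A ∩ B) ≤ 1 := measureReal_le_one
  have h2 : P.real A * P.real B ≤ 1 :=
    mul_le_one₀ measureReal_le_one measureReal_nonneg measureReal_le_one
  have h3 : 0 ≤ P.real A * P.real B := by positivity
  have h4 : 0 ≤ P.real (A ∩ B) := measureReal_nonneg
  rw [eventCov, abs_le]
  constructor <;> linarith

/-- For random signs `ε j`, the diagonal sum is the mean of the bilinear form `∑ ε i * ε j * c i j`,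
so some choice of signs does at least as well. `S` and `T` are the unions of the cells with sign
plus and minus. The induction picks the signs one by one. -/
theorem exists_sum_eventCov_le {ι E : Type*} [MeasurableSpace E] {U V : Ω → E}
    (hU : Measurable U) (hV : Measurable V) {π : ι → Set E} (hπ : ∀ j, MeasurableSet (π j))
    (hd : Pairwise (Function.onFun Disjoint π)) (J : Finset ι) :
    ∃ S T : Set E, MeasurableSet S ∧ MeasurableSet T ∧ S ⊆ ⋃ j ∈ J, π j ∧ T ⊆ ⋃ j ∈ J, π j ∧
      ∑ j ∈ J, eventCov P (U ⁻¹' π j) (V ⁻¹' π j) ≤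
        eventCov P (U ⁻¹' S) (V ⁻¹' S) - eventCov P (U ⁻¹' S) (V ⁻¹' T) -
          eventCov P (U ⁻¹' T) (V ⁻¹' S) + eventCov P (U ⁻¹' T) (V ⁻¹' T) := by
  classical
  induction J using Finset.induction_on with
  | empty => exact ⟨∅, ∅, .empty, .empty, by simp, by simp, by simp [eventCov]⟩
  | insert i J hi ih =>
    obtain ⟨S, T, hS, hT, hSJ, hTJ, hle⟩ := ih
    have hJi : Disjoint (⋃ j ∈ J, π j) (π i) := by
      simp only [Set.disjoint_iUnion_left]
      intro j hj
      exact hd (ne_of_mem_of_not_mem hj hi)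
    have hSi := hJi.mono_left hSJ
    have hTi := hJi.mono_left hTJ
    have hsub : (⋃ j ∈ J, π j) ⊆ ⋃ j ∈ insert i J, π j :=
      Set.biUnion_subset_biUnion_left fun j hj => Finset.mem_insert_of_mem hj
    have hisub : π i ⊆ ⋃ j ∈ insert i J, π j :=
      Set.subset_biUnion_of_mem (u := π) (Finset.mem_insert_self i J)
    have eL : ∀ {A : Set E} (B : Set E), MeasurableSet B → Disjoint A (π i) →
        eventCov P (U ⁻¹' (A ∪ π i)) (V ⁻¹' B) =
          eventCov P (U ⁻¹' A) (V ⁻¹' B) + eventCov P (U ⁻¹' π i) (V ⁻¹' B) :=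
      fun B hB hA => eventCov_union_left (hU (hπ i)) (hV hB) (hA.preimage U)
    have eR : ∀ {A : Set E} (B : Set E), MeasurableSet B → Disjoint A (π i) →
        eventCov P (U ⁻¹' B) (V ⁻¹' (A ∪ π i)) =
          eventCov P (U ⁻¹' B) (V ⁻¹' A) + eventCov P (U ⁻¹' B) (V ⁻¹' π i) :=
      fun B hB hA => eventCov_union_right (hU hB) (hV (hπ i)) (hA.preimage V)
    rw [Finset.sum_insert hi]
    -- Adding cell `i` with a sign changes the form by its diagonal term plus that sign times this
    -- cross term; the sign is chosen to make the latter nonnegative.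
    rcases le_total 0 (eventCov P (U ⁻¹' S) (V ⁻¹' π i) - eventCov P (U ⁻¹' T) (V ⁻¹' π i) +
      eventCov P (U ⁻¹' π i) (V ⁻¹' S) - eventCov P (U ⁻¹' π i) (V ⁻¹' T)) with h0 | h0
    · refine ⟨S ∪ π i, T, hS.union (hπ i), hT, Set.union_subset (hSJ.trans hsub) hisub,
        hTJ.trans hsub, ?_⟩
      rw [eL _ (hS.union (hπ i)) hSi, eR _ hS hSi, eR _ (hπ i) hSi, eL _ hT hSi, eR _ hT hSi]
      linarith
    · refine ⟨S, T ∪ π i, hS, hT.union (hπ i), hSJ.trans hsub,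
        Set.union_subset (hTJ.trans hsub) hisub, ?_⟩
      rw [eL _ (hT.union (hπ i)) hTi, eR _ hT hTi, eR _ (hπ i) hTi, eL _ hS hTi, eR _ hS hTi]
      linarith

/-- The covariances of the indicators of the cells of a partition add up to at most four times
the mixing coefficient, whatever the number of cells. -/
theorem sum_eventCov_le_four_mul {ι E : Type*} [MeasurableSpace E] {U V : Ω → E}
    (hU : Measurable U) (hV : Measurable V) {π : ι → Set E} (hπ : ∀ j, MeasurableSet (π j))
    (hd : Pairwise (Function.onFun Disjoint π)) (J : Finset ι) {a : ℝ}
    (ha : ∀ A B, MeasurableSet A → MeasurableSet B →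
      |eventCov P (U ⁻¹' A) (V ⁻¹' B)| ≤ a) :
    ∑ j ∈ J, eventCov P (U ⁻¹' π j) (V ⁻¹' π j) ≤ 4 * a := by
  obtain ⟨S, T, hS, hT, -, -, hle⟩ := exists_sum_eventCov_le (P := P) hU hV hπ hd J
  have h1 := abs_le.1 (ha S S hS hS)
  have h2 := abs_le.1 (ha S T hS hT)
  have h3 := abs_le.1 (ha T S hT hS)
  have h4 := abs_le.1 (ha T T hT hT)
  linarith [h1.2, h2.1, h3.1, h4.2]

theorem abs_eventCov_le_alphaTwo {d : ℕ} (X : ℝ → Ω → (Fin d → ℝ)) (s u : ℝ)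
    {A B : Set (Fin d → ℝ)} (hA : MeasurableSet A) (hB : MeasurableSet B) :
    |eventCov P (X s ⁻¹' A) (X (s + u) ⁻¹' B)| ≤ alphaTwo P X u := by
  -- A real supremum dominates its members only if the set is bounded above.
  have hone : ∀ m₁ m₂ : MeasurableSpace Ω, 1 ∈ upperBounds {a : ℝ | ∃ A B : Set Ω,
      MeasurableSet[m₁] A ∧ MeasurableSet[m₂] B ∧
        a = |P.real (A ∩ B) - P.real A * P.real B|} := by
    rintro m₁ m₂ a ⟨A, B, -, -, rfl⟩
    exact abs_eventCov_le_one A B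
  have h1 : alphaCoeff P (MeasurableSpace.comap (X s) inferInstance)
      (MeasurableSpace.comap (X (s + u)) inferInstance) ≤ alphaTwo P X u := by
    refine le_ciSup (f := fun t : ℝ => alphaCoeff P (MeasurableSpace.comap (X t) inferInstance)
      (MeasurableSpace.comap (X (t + u)) inferInstance)) ⟨1, ?_⟩ s
    rintro _ ⟨t, rfl⟩
    exact Real.sSup_le (hone _ _) zero_le_one
  refine le_trans ?_ h1
  exact le_csSup ⟨1, hone _ _⟩ ⟨_, _, ⟨A, hA, rfl⟩, ⟨B, hB, rfl⟩, rfl⟩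

variable {d : ℕ} {X : ℝ → Ω → (Fin d → ℝ)} {f : (Fin d → ℝ) → ℝ}
  {fJ : ℝ → (Fin d → ℝ) → (Fin d → ℝ) → ℝ} {h : ℝ}

theorem sum_real_preimage_bin_le_one (hh : 0 < h) (b : Fin d → ℝ) (J : Finset (Fin d → ℤ))
    {U : Ω → (Fin d → ℝ)} (hU : Measurable U) :
    ∑ j ∈ J, P.real (U ⁻¹' bin h b j) ≤ 1 := by
  rw [← measureReal_biUnion_finset
    (fun i _ j _ hij => (pairwise_disjoint_bin hh hij).preimage U)
    (fun j _ => hU (measurableSet_bin j))]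
  exact measureReal_le_one

theorem binCov_le_one (hh : 0 < h) (b : Fin d → ℝ) (J : Finset (Fin d → ℤ))
    (hX : ∀ t, Measurable (X t)) (s r : ℝ) : binCov P X h b J s r ≤ 1 :=
  (Finset.sum_le_sum fun _ _ => eventCov_le_real _ _).trans
    (sum_real_preimage_bin_le_one hh b J (hX s))

theorem binCov_le_alphaTwo (hh : 0 < h) (b : Fin d → ℝ) (J : Finset (Fin d → ℤ))
    (hX : ∀ t, Measurable (X t)) (s r : ℝ) : binCov P X h b J s r ≤ 4 * alphaTwo P X |r - s| := by
  wlog hsr : s ≤ r generalizing s r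
  · rw [binCov_comm, abs_sub_comm]
    exact this r s (le_of_not_ge hsr)
  refine sum_eventCov_le_four_mul (hX s) (hX r) measurableSet_bin (pairwise_disjoint_bin hh) J
    fun A B hA hB => ?_
  have := abs_eventCov_le_alphaTwo (P := P) X s |r - s| hA hB
  rw [abs_of_nonneg (sub_nonneg.2 hsr), add_sub_cancel] at this
  rwa [abs_of_nonneg (sub_nonneg.2 hsr)]

/-- The joint density is at most `f y * f z + k y`; integrating `k y` over `z` in the bin gives the
factor `h ^ d`. The remaining integral of `k` can be summed over disjoint bins, which keeps the
total bound free of their number. -/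
theorem eventCov_bin_le_of_deviation (hX : IsPairStationary P X f fJ) (hh : 0 < h)
    (b : Fin d → ℝ) {k : (Fin d → ℝ) → ℝ} (hk0 : ∀ y, 0 < k y) (hkc : Continuous k)
    (hki : Integrable k) {s r : ℝ} (hsr : s ≠ r)
    (hdev : ∀ y z, |jointDeviation f fJ |r - s| y z| ≤ k y) (j : Fin d → ℤ) :
    eventCov P (X s ⁻¹' bin h b j) (X r ⁻¹' bin h b j) ≤ h ^ d * ∫ y in bin h b j, k y := by
  set Q := bin h b j with hQ
  have hQm : MeasurableSet Q := measurableSet_bin j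
  have hf := hX.marginal s
  have hmarg : ∀ t, P (X t ⁻¹' Q) = ∫⁻ y in Q, ENNReal.ofReal (f y) := fun t => by
    rw [← Measure.map_apply (hX.measurable t) hQm, (hX.marginal t).eq_withDensity,
      withDensity_apply _ hQm]
  have hjoint : P (X s ⁻¹' Q ∩ X r ⁻¹' Q) =
      ∫⁻ q in Q ×ˢ Q, ENNReal.ofReal (fJ |r - s| q.1 q.2) := by
    rw [← withDensity_apply _ (hQm.prod hQm), ← (hX.joint s r hsr).eq_withDensity,
      Measure.map_apply ((hX.measurable s).prodMk (hX.measurable r)) (hQm.prod hQm)]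
    rfl
  have hle : P (X s ⁻¹' Q ∩ X r ⁻¹' Q) ≤ P (X s ⁻¹' Q) * P (X r ⁻¹' Q) +
      ENNReal.ofReal (h ^ d * ∫ y in Q, k y) := by
    rw [hjoint, hmarg, hmarg, Measure.volume_eq_prod, ← Measure.prod_restrict]
    calc _ ≤ ∫⁻ q, (ENNReal.ofReal (f q.1) * ENNReal.ofReal (f q.2) + ENNReal.ofReal (k q.1))
          ∂((volume.restrict Q).prod (volume.restrict Q)) := by
          refine lintegral_mono fun q => ?_
          rw [← ENNReal.ofReal_mul (hf.nonneg _),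
            ← ENNReal.ofReal_add (mul_nonneg (hf.nonneg _) (hf.nonneg _)) (hk0 _).le]
          refine ENNReal.ofReal_le_ofReal ?_
          have := (abs_le.1 (hdev q.1 q.2)).2
          rw [jointDeviation] at this
          linarith
      _ = _ := by
          have hfm := hf.measurable.ennreal_ofReal
          rw [lintegral_add_right _ (by fun_prop),
            lintegral_prod_mul hfm.aemeasurable hfm.aemeasurable,
            lintegral_prod _ (by fun_prop)]
          simp only [lintegral_const, Measure.restrict_apply_univ, hQ, volume_bin hh]
          rw [lintegral_mul_const _ (by fun_prop), ENNReal.ofReal_mul (by positivity),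
            ofReal_integral_eq_lintegral_ofReal hki.integrableOn
              (ae_of_all _ fun y => (hk0 y).le), mul_comm (ENNReal.ofReal (h ^ d))]
  have hK : 0 ≤ h ^ d * ∫ y in Q, k y :=
    mul_nonneg (by positivity) (integral_nonneg fun y => (hk0 y).le)
  have h1 := ENNReal.toReal_mono (by finiteness) hle
  rw [ENNReal.toReal_add (by finiteness) (by finiteness), ENNReal.toReal_mul,
    ENNReal.toReal_ofReal hK] at h1
  rw [eventCov, Measure.real, Measure.real, Measure.real]
  linarith

theorem binCov_le_of_deviation (hX : IsPairStationary P X f fJ) (hh : 0 < h)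
    (b : Fin d → ℝ) (J : Finset (Fin d → ℤ)) {k : (Fin d → ℝ) → ℝ} (hk0 : ∀ y, 0 < k y)
    (hkc : Continuous k) (hki : Integrable k) {s r : ℝ} (hsr : s ≠ r)
    (hdev : ∀ y z, |jointDeviation f fJ |r - s| y z| ≤ k y) :
    binCov P X h b J s r ≤ h ^ d * ∫ y, k y := by
  calc _ ≤ ∑ j ∈ J, h ^ d * ∫ y in bin h b j, k y :=
        Finset.sum_le_sum fun j _ => eventCov_bin_le_of_deviation hX hh b hk0 hkc hki hsr hdev j
    _ = h ^ d * ∫ y in ⋃ j ∈ J, bin h b j, k y := by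
        rw [← Finset.mul_sum, integral_biUnion_finset J (fun j _ => measurableSet_bin j)
          (fun i _ j _ hij => pairwise_disjoint_bin hh hij) fun j _ => hki.integrableOn]
    _ ≤ _ := by
        exact mul_le_mul_of_nonneg_left
          (setIntegral_le_integral hki (ae_of_all _ fun y => (hk0 y).le)) (by positivity)

end Covariance

/-! ### Conditioning on the independent sampling times -/

section RandomTimes

variable {Ω : Type*} {mΩ : MeasurableSpace Ω} {P : Measure Ω}

theorem IsPairStationary.real_preimage_eq {d : ℕ}
    {X : ℝ → Ω → (Fin d → ℝ)} {f : (Fin d → ℝ) → ℝ} {fJ : ℝ → (Fin d → ℝ) → (Fin d → ℝ) → ℝ}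
    (hX : IsPairStationary P X f fJ) (s r : ℝ)
    {A : Set (Fin d → ℝ)} (hA : MeasurableSet A) : P.real (X s ⁻¹' A) = P.real (X r ⁻¹' A) := by
  rw [Measure.real, Measure.real, ← Measure.map_apply (hX.measurable s) hA,
    ← Measure.map_apply (hX.measurable r) hA, (hX.marginal s).eq_withDensity,
    (hX.marginal r).eq_withDensity]

theorem integral_indicator_preimage {E : Type*} [MeasurableSpace E] {U : Ω → E}
    (hU : Measurable U) {A : Set E} (hA : MeasurableSet A) :
    ∫ ω, A.indicator (fun _ => (1 : ℝ)) (U ω) ∂P = P.real (U ⁻¹' A) := by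
  have h1 : (fun ω => A.indicator (fun _ => (1 : ℝ)) (U ω)) = (U ⁻¹' A).indicator 1 := by
    ext ω; by_cases hω : U ω ∈ A <;> simp [hω]
  rw [h1, integral_indicator_one (hU hA)]

variable [IsProbabilityMeasure P]

/-- Fubini: by independence the joint law of `(T, W)` is a product, so `T` may be frozen. -/
theorem measurable_and_real_preimage_eq_integral {S Ω' : Type*} [MeasurableSpace S]
    [MeasurableSpace Ω'] {T : Ω → S} {W : Ω → Ω'} (hT : Measurable T) (hW : Measurable W)
    (hTW : IndepFun T W P) {H : Set (S × Ω')} (hH : MeasurableSet H) :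
    Measurable (fun ω => P.real {ω' | (T ω, W ω') ∈ H}) ∧
      P.real {ω | (T ω, W ω) ∈ H} = ∫ ω, P.real {ω' | (T ω, W ω') ∈ H} ∂P := by
  have : IsProbabilityMeasure (P.map W) := Measure.isProbabilityMeasure_map hW.aemeasurable
  have h1 : ∀ s, P {ω' | (s, W ω') ∈ H} = P.map W (Prod.mk s ⁻¹' H) := fun s =>
    (Measure.map_apply hW (measurable_prodMk_left hH)).symm
  have h2 : Measurable fun s => P {ω' | (s, W ω') ∈ H} := by
    simp only [h1]
    exact measurable_measure_prodMk_left hH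
  refine ⟨(h2.comp hT).ennreal_toReal, ?_⟩
  have h3 : P {ω | (T ω, W ω) ∈ H} = ∫⁻ ω, P {ω' | (T ω, W ω') ∈ H} ∂P := by
    have h4 : P {ω | (T ω, W ω) ∈ H} = P.map (fun ω => (T ω, W ω)) H :=
      (Measure.map_apply (hT.prodMk hW) hH).symm
    rw [h4, hTW.map_prod_eq_prod_map_map hT.aemeasurable hW.aemeasurable,
      Measure.prod_apply hH]
    simp only [← h1]
    exact lintegral_map h2 hT
  simp only [Measure.real]
  have h5 : Measurable fun ω => P {ω' | (T ω, W ω') ∈ H} := h2.comp hT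
  rw [h3, integral_toReal h5.aemeasurable (ae_of_all _ fun ω => measure_lt_top _ _)]

theorem measurable_and_real_inter_eq_integral {E Ω' : Type*} [MeasurableSpace E]
    [MeasurableSpace Ω'] {W : Ω → Ω'} (hW : Measurable W) {X : ℝ≥0 → Ω' → E}
    (hX : Measurable fun q : ℝ≥0 × Ω' => X q.1 q.2) {T₁ T₂ : Ω → ℝ≥0} (hT₁ : Measurable T₁)
    (hT₂ : Measurable T₂) (hTW : IndepFun (fun ω => (T₁ ω, T₂ ω)) W P) :
    Measurable (fun ω => X (T₁ ω) (W ω)) ∧ ∀ A B : Set E, MeasurableSet A → MeasurableSet B →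
      Measurable (fun ω => P.real {ω' | X (T₁ ω) (W ω') ∈ A ∧ X (T₂ ω) (W ω') ∈ B}) ∧
      P.real {ω | X (T₁ ω) (W ω) ∈ A ∧ X (T₂ ω) (W ω) ∈ B} =
        ∫ ω, P.real {ω' | X (T₁ ω) (W ω') ∈ A ∧ X (T₂ ω) (W ω') ∈ B} ∂P := by
  refine ⟨hX.comp (hT₁.prodMk hW), fun A B hA hB => ?_⟩
  have h1 : Measurable fun q : (ℝ≥0 × ℝ≥0) × Ω' => X q.1.1 q.2 :=
    hX.comp ((measurable_fst.comp measurable_fst).prodMk measurable_snd)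
  have h2 : Measurable fun q : (ℝ≥0 × ℝ≥0) × Ω' => X q.1.2 q.2 :=
    hX.comp ((measurable_snd.comp measurable_fst).prodMk measurable_snd)
  exact measurable_and_real_preimage_eq_integral (hT₁.prodMk hT₂) hW hTW ((h1 hA).inter (h2 hB))

variable {d : ℕ} {X : ℝ → Ω → (Fin d → ℝ)} {t : ℕ → Ω → ℝ}

/-- The process observed at the time `t k`, negative times being replaced by `0`. -/
def observed (X : ℝ → Ω → (Fin d → ℝ)) (t : ℕ → Ω → ℝ) (k : ℕ) (ω : Ω) : Fin d → ℝ :=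
  X ((t k ω).toNNReal : ℝ) ω

theorem measurable_and_real_observed (hI : IndepOfProcess P X t) (ht : ∀ k, Measurable (t k))
    (k l : ℕ) :
    Measurable (observed X t k) ∧
      ∀ A B : Set (Fin d → ℝ), MeasurableSet A → MeasurableSet B →
      Measurable (fun ω => P.real (X ((t k ω).toNNReal : ℝ) ⁻¹' A ∩
        X ((t l ω).toNNReal : ℝ) ⁻¹' B)) ∧
      P.real (observed X t k ⁻¹' A ∩ observed X t l ⁻¹' B) =
        ∫ ω, P.real (X ((t k ω).toNNReal : ℝ) ⁻¹' A ∩ X ((t l ω).toNNReal : ℝ) ⁻¹' B) ∂P := by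
  obtain ⟨𝓖, h𝓖, hX, hind⟩ := hI
  have h1 : ∀ k, Measurable[mΩ] fun ω => (t k ω).toNNReal := fun k => (ht k).real_toNNReal
  have hT : Indep (MeasurableSpace.comap (fun ω => ((t k ω).toNNReal, (t l ω).toNNReal))
      inferInstance) 𝓖 P := by
    refine indep_of_indep_of_le_left hind.symm ?_
    have h2 : ∀ k, MeasurableSpace.comap (fun ω => (t k ω).toNNReal) inferInstance ≤
        ⨆ k, MeasurableSpace.comap (t k) inferInstance := by
      intro k
      refine le_trans ?_ (le_iSup _ k)
      have : (fun ω => (t k ω).toNNReal) = Real.toNNReal ∘ t k := rfl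
      rw [this, ← MeasurableSpace.comap_comp]
      exact MeasurableSpace.comap_mono measurable_real_toNNReal.comap_le
    refine (MeasurableSpace.comap_prodMk _ _).trans_le (sup_le (h2 k) (h2 l))
  -- `W` is the identity of `Ω`, viewed as a map onto `Ω` with the σ-algebra `𝓖`; its independence
  -- from the times is then that of `𝓖`.
  exact @measurable_and_real_inter_eq_integral Ω mΩ P _ (Fin d → ℝ) Ω _ 𝓖 id
    (measurable_id'' h𝓖) (fun s ω => X s ω) hX _ _ (h1 k) (h1 l)
    ((IndepFun_iff_Indep _ _ _).2 (by rwa [MeasurableSpace.comap_id]))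

theorem measurable_observed (hI : IndepOfProcess P X t) (ht : ∀ k, Measurable (t k)) (k : ℕ) :
    Measurable (observed X t k) :=
  (measurable_and_real_observed hI ht k k).1

variable {f : (Fin d → ℝ) → ℝ} {fJ : ℝ → (Fin d → ℝ) → (Fin d → ℝ) → ℝ} {h : ℝ}

theorem real_preimage_observed (hX : IsPairStationary P X f fJ) (hI : IndepOfProcess P X t)
    (ht : ∀ k, Measurable (t k)) (k : ℕ) {A : Set (Fin d → ℝ)} (hA : MeasurableSet A) :
    P.real (observed X t k ⁻¹' A) = P.real (X 0 ⁻¹' A) := by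
  have := ((measurable_and_real_observed hI ht k k).2 A A hA hA).2
  simp only [Set.inter_self, hX.real_preimage_eq _ 0 hA] at this
  simpa using this

/-- By the law of total covariance there is also a covariance of conditional means, but these are
constant because all `X s` have the same law. -/
theorem eventCov_observed (hX : IsPairStationary P X f fJ) (hI : IndepOfProcess P X t)
    (ht : ∀ k, Measurable (t k)) (k l : ℕ) {A : Set (Fin d → ℝ)} (hA : MeasurableSet A) :
    Integrable (fun ω => eventCov P (X ((t k ω).toNNReal : ℝ) ⁻¹' A)
        (X ((t l ω).toNNReal : ℝ) ⁻¹' A)) P ∧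
      eventCov P (observed X t k ⁻¹' A) (observed X t l ⁻¹' A) =
        ∫ ω, eventCov P (X ((t k ω).toNNReal : ℝ) ⁻¹' A) (X ((t l ω).toNNReal : ℝ) ⁻¹' A) ∂P := by
  obtain ⟨hm, he⟩ := (measurable_and_real_observed hI ht k l).2 A A hA hA
  have hi : Integrable (fun ω => P.real (X ((t k ω).toNNReal : ℝ) ⁻¹' A ∩
      X ((t l ω).toNNReal : ℝ) ⁻¹' A)) P := by
    refine Integrable.of_bound hm.aestronglyMeasurable 1 (ae_of_all _ fun ω => ?_)
    rw [Real.norm_of_nonneg measureReal_nonneg]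
    exact measureReal_le_one
  simp only [eventCov, real_preimage_observed hX hI ht _ hA, hX.real_preimage_eq _ 0 hA]
  refine ⟨hi.sub (integrable_const _), ?_⟩
  rw [integral_sub hi (integrable_const _), he]
  simp

theorem sum_eventCov_observed (hX : IsPairStationary P X f fJ) (hI : IndepOfProcess P X t)
    (ht : ∀ k, Measurable (t k)) (h : ℝ) (b : Fin d → ℝ) (J : Finset (Fin d → ℤ)) (k l : ℕ) :
    ∑ j ∈ J, eventCov P (observed X t k ⁻¹' bin h b j) (observed X t l ⁻¹' bin h b j) =
      ∫ ω, binCov P X h b J (t k ω).toNNReal (t l ω).toNNReal ∂P := by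
  simp only [binCov]
  rw [integral_finsetSum _ fun j _ => (eventCov_observed hX hI ht k l (measurableSet_bin j)).1]
  exact Finset.sum_congr rfl fun j _ => (eventCov_observed hX hI ht k l (measurableSet_bin j)).2

/-- The number of observations among the first `n` which fall into a bin. -/
noncomputable def binCount (X : ℝ → Ω → (Fin d → ℝ)) (t : ℕ → Ω → ℝ) (n : ℕ) (A : Set (Fin d → ℝ))
    (ω : Ω) : ℝ :=
  ∑ k ∈ Finset.Icc 1 n, A.indicator (fun _ => (1 : ℝ)) (observed X t k ω)

theorem memLp_indicator_preimage {E : Type*} [MeasurableSpace E] {U : Ω → E} (hU : Measurable U)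
    {A : Set E} (hA : MeasurableSet A) :
    MemLp (fun ω => A.indicator (fun _ => (1 : ℝ)) (U ω)) 2 P :=
  MemLp.of_bound ((measurable_const.indicator hA).comp hU).aestronglyMeasurable 1
    (ae_of_all _ fun ω => (norm_indicator_le_norm_self _ _).trans (by simp))

theorem covariance_indicator_preimage {E : Type*} [MeasurableSpace E] {U V : Ω → E}
    (hU : Measurable U) (hV : Measurable V) {A : Set E} (hA : MeasurableSet A) :
    cov[fun ω => A.indicator (fun _ => (1 : ℝ)) (U ω),
      fun ω => A.indicator (fun _ => (1 : ℝ)) (V ω); P] = eventCov P (U ⁻¹' A) (V ⁻¹' A) := by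
  rw [covariance_eq_sub (memLp_indicator_preimage hU hA) (memLp_indicator_preimage hV hA),
    integral_indicator_preimage hU hA, integral_indicator_preimage hV hA, eventCov]
  have h1 : (fun ω => A.indicator (fun _ => (1 : ℝ)) (U ω)) *
      (fun ω => A.indicator (fun _ => (1 : ℝ)) (V ω)) = (U ⁻¹' A ∩ V ⁻¹' A).indicator 1 := by
    ext ω
    by_cases h1 : U ω ∈ A <;> by_cases h2 : V ω ∈ A <;> simp [h1, h2]
  rw [h1, integral_indicator_one ((hU hA).inter (hV hA))]

theorem sum_Icc_sum_Icc_eq {c : ℕ → ℕ → ℝ} (hc : ∀ k l, c k l = c l k) (n : ℕ) :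
    ∑ k ∈ Finset.Icc 1 n, ∑ l ∈ Finset.Icc 1 n, c k l =
      ∑ k ∈ Finset.Icc 1 n, c k k + 2 * ∑ k ∈ Finset.Icc 1 n, ∑ l ∈ Finset.Ioc k n, c k l := by
  induction n with
  | zero => simp
  | succ n ih =>
    have h1 : ∑ k ∈ Finset.Icc 1 n, ∑ l ∈ Finset.Ioc k (n + 1), c k l =
        ∑ k ∈ Finset.Icc 1 n, ∑ l ∈ Finset.Ioc k n, c k l + ∑ k ∈ Finset.Icc 1 n, c k (n + 1) := by
      rw [← Finset.sum_add_distrib]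
      refine Finset.sum_congr rfl fun k hk => ?_
      rw [Finset.sum_Ioc_succ_top (Finset.mem_Icc.1 hk).2]
    have h2 : ∑ l ∈ Finset.Icc 1 n, c (n + 1) l = ∑ k ∈ Finset.Icc 1 n, c k (n + 1) :=
      Finset.sum_congr rfl fun k _ => hc _ _
    simp only [Finset.sum_Icc_succ_top (Nat.le_add_left 1 n), Finset.sum_add_distrib, ih, h1, h2,
      Finset.Ioc_self, Finset.sum_empty]
    ring

/-- The diagonal covariances are at most the bin probabilities, whose sum is at most one for each of
the `n` observations. -/
theorem sum_variance_binCount_le (hX : IsPairStationary P X f fJ) (hI : IndepOfProcess P X t)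
    (ht : ∀ k, Measurable (t k)) (hh : 0 < h) (b : Fin d → ℝ) (J : Finset (Fin d → ℤ)) (n : ℕ) :
    ∑ j ∈ J, Var[binCount X t n (bin h b j); P] ≤ n + 2 * ∑ k ∈ Finset.Icc 1 n,
      ∑ l ∈ Finset.Ioc k n, ∫ ω, binCov P X h b J (t k ω).toNNReal (t l ω).toNNReal ∂P := by
  have hY := measurable_observed hI ht
  have h1 : ∀ j, Var[binCount X t n (bin h b j); P] =
      ∑ k ∈ Finset.Icc 1 n, ∑ l ∈ Finset.Icc 1 n,
        eventCov P (observed X t k ⁻¹' bin h b j) (observed X t l ⁻¹' bin h b j) := by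
    intro j
    have := variance_fun_sum' (μ := P) (s := Finset.Icc 1 n)
      (X := fun k ω => (bin h b j).indicator (fun _ => (1 : ℝ)) (observed X t k ω))
      fun k _ => memLp_indicator_preimage (hY k) (measurableSet_bin j)
    simp only [covariance_indicator_preimage (hY _) (hY _) (measurableSet_bin j)] at this
    exact this
  simp only [h1]
  rw [Finset.sum_comm]
  simp only [Finset.sum_comm (s := J) (t := Finset.Icc 1 n)]
  rw [sum_Icc_sum_Icc_eq fun k l => Finset.sum_congr rfl fun j _ => eventCov_comm _ _]
  simp only [← sum_eventCov_observed hX hI ht]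
  gcongr
  calc _ ≤ ∑ k ∈ Finset.Icc 1 n, (1 : ℝ) := Finset.sum_le_sum fun k _ =>
        (Finset.sum_le_sum fun j _ => eventCov_le_real _ _).trans
          (sum_real_preimage_bin_le_one hh b J (hY k))
    _ = n := by simp

end RandomTimes

/-! ### Expected numbers of sampling times at a given lag -/

section Sampling

variable {Ω : Type*} {mΩ : MeasurableSpace Ω} {P : Measure Ω}

/-- Bounds on the expected numbers of sampling times at a distance less than `u₀` after `t k`, and
at a distance in `[m, m + 1)` after `t k`. -/
structure SpacingBound (P : Measure Ω) (t : ℕ → Ω → ℝ) (u₀ : ℝ) (C D : ℝ≥0∞) : Prop where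
  measurable : ∀ k, Measurable (t k)
  nonneg : ∀ k, 1 ≤ k → ∀ᵐ ω ∂P, 0 ≤ t k ω
  short : ∀ k, ∑' i, P {ω | |t (k + 1 + i) ω - t k ω| < u₀} ≤ C
  unit : ∀ k, ∀ m : ℕ, ∑' i, P {ω | (m : ℝ) ≤ |t (k + 1 + i) ω - t k ω| ∧
    |t (k + 1 + i) ω - t k ω| < m + 1} ≤ D

variable [IsProbabilityMeasure P]

theorem measurable_convPow {g : ℝ → ℝ} (hg : Measurable g) (i : ℕ) : Measurable (convPow g i) := by
  induction i with
  | zero => exact hg.ennreal_ofReal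
  | succ i ih =>
    refine Measurable.lintegral_prod_right' (f := fun q : ℝ × ℝ =>
      convPow g i (q.1 - q.2) * ENNReal.ofReal (g q.2)) ?_
    exact (ih.comp (measurable_fst.sub measurable_snd)).mul (hg.ennreal_ofReal.comp measurable_snd)

theorem map_sum_eq_withDensity_convPow {τ : ℕ → Ω → ℝ} {g : ℝ → ℝ} (hm : ∀ j, Measurable (τ j))
    (hind : iIndepFun τ P) (hd : ∀ j, IsDensity (P.map (τ j)) g) (k i : ℕ) :
    P.map (∑ j ∈ Finset.range (i + 1), τ (k + j)) = volume.withDensity (convPow g i) := by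
  have hg : Measurable g := (hd 0).measurable
  induction i with
  | zero =>
    simp only [zero_add, Finset.range_one, Finset.sum_singleton, add_zero]
    exact (hd k).eq_withDensity
  | succ i ih =>
    have hind' : iIndepFun (fun j => τ (k + j)) P := hind.precomp (add_right_injective k)
    have h1 : IndepFun (τ (k + (i + 1))) (∑ j ∈ Finset.range (i + 1), τ (k + j)) P :=
      (hind'.indepFun_sum_range_succ (fun j => hm _) (i + 1)).symm
    have hS : Measurable (∑ j ∈ Finset.range (i + 1), τ (k + j)) :=
      Finset.sum_induction _ _ (fun _ _ => Measurable.add) measurable_zero fun j _ => hm _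
    have hp : IsProbabilityMeasure (P.map (τ (k + (i + 1)))) :=
      Measure.isProbabilityMeasure_map (hm _).aemeasurable
    have hp' : IsProbabilityMeasure (P.map (∑ j ∈ Finset.range (i + 1), τ (k + j))) :=
      Measure.isProbabilityMeasure_map hS.aemeasurable
    rw [Finset.sum_range_succ, add_comm,
      h1.map_add_eq_map_conv_map' (hm _) hS inferInstance inferInstance, ih,
      (hd _).eq_withDensity,
      conv_withDensity_eq_lconvolution hg.ennreal_ofReal (measurable_convPow hg i)]
    congr 1
    ext x
    rw [lconvolution_def, convPow]
    refine lintegral_congr fun y => ?_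
    rw [mul_comm, neg_add_eq_sub]

/-- The sums started at `k` have the convolution powers of `g` as densities, so the total is the
integral of the renewal density over `B`. The bound on that density holds on the positive half-line,
whence `hB0`. -/
theorem tsum_measure_sum_mem_le {τ : ℕ → Ω → ℝ} {g : ℝ → ℝ} {h₀ : ℝ} (hm : ∀ j, Measurable (τ j))
    (hind : iIndepFun τ P) (hd : ∀ j, IsDensity (P.map (τ j)) g)
    (hren : ∀ s, 0 < s → renewalDensity g s ≤ ENNReal.ofReal h₀) (k : ℕ) {B : Set ℝ}
    (hB : MeasurableSet B) (hB0 : B ⊆ Set.Ioi 0) :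
    ∑' i, P {ω | (∑ j ∈ Finset.range (i + 1), τ (k + j) ω) ∈ B} ≤
      ENNReal.ofReal h₀ * volume B := by
  have h1 : ∀ i, P {ω | (∑ j ∈ Finset.range (i + 1), τ (k + j) ω) ∈ B} =
      ∫⁻ x in B, convPow g i x := by
    intro i
    have hS : Measurable (∑ j ∈ Finset.range (i + 1), τ (k + j)) :=
      Finset.sum_induction _ _ (fun _ _ => Measurable.add) measurable_zero fun j _ => hm _
    rw [← withDensity_apply _ hB, ← map_sum_eq_withDensity_convPow hm hind hd k i,
      Measure.map_apply hS hB]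
    congr 1
    ext ω
    simp
  simp only [h1]
  rw [← lintegral_tsum fun i => (measurable_convPow (hd 0).measurable i).aemeasurable]
  calc _ ≤ ∫⁻ _x in B, ENNReal.ofReal h₀ := setLIntegral_mono' hB fun x hx => hren x (hB0 hx)
    _ = _ := setLIntegral_const _ _

variable {d : ℕ} {X : ℝ → Ω → (Fin d → ℝ)} {t : ℕ → Ω → ℝ}

theorem IsRenewalSampling.spacingBound {τ : ℕ → Ω → ℝ} {g : ℝ → ℝ} {h₀ : ℝ}
    (hS : IsRenewalSampling P X t τ g h₀) (u₀ : ℝ) :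
    SpacingBound P t u₀ (ENNReal.ofReal h₀ * ENNReal.ofReal u₀) (ENNReal.ofReal h₀) := by
  have hpos : ∀ᵐ ω ∂P, ∀ j, 0 < τ j ω := ae_all_iff.2 hS.pos
  have hdiff : ∀ k i ω, t (k + 1 + i) ω - t k ω = ∑ j ∈ Finset.range (i + 1), τ (k + j) ω := by
    intro k i ω
    rw [hS.time_eq, hS.time_eq, add_assoc, add_comm 1 i, Finset.sum_range_add, add_sub_cancel_left]
  have key : ∀ (k : ℕ) (B : Set ℝ), MeasurableSet B →
      ∑' i, P {ω | |t (k + 1 + i) ω - t k ω| ∈ B} ≤ ENNReal.ofReal h₀ * volume (B ∩ Set.Ioi 0) := by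
    intro k B hB
    refine le_trans (ENNReal.tsum_le_tsum fun i => ?_) (tsum_measure_sum_mem_le hS.measurable
      hS.indep hS.density hS.renewal_le k (hB.inter measurableSet_Ioi) Set.inter_subset_right)
    refine measure_mono_ae ?_
    filter_upwards [hpos] with ω hω hB'
    have h1 : 0 < ∑ j ∈ Finset.range (i + 1), τ (k + j) ω :=
      Finset.sum_pos (fun j _ => hω _) (by simp)
    have hB'' : |t (k + 1 + i) ω - t k ω| ∈ B := hB'
    rw [hdiff, abs_of_pos h1] at hB''
    exact ⟨hB'', h1⟩
  refine ⟨fun k => ?_, fun k _ => ?_, fun k => ?_, fun k m => ?_⟩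
  · have : t k = fun ω => ∑ j ∈ Finset.range k, τ j ω := funext fun ω => hS.time_eq k ω
    rw [this]
    exact Finset.measurable_fun_sum _ fun j _ => hS.measurable j
  · filter_upwards [hpos] with ω hω
    rw [hS.time_eq]
    exact Finset.sum_nonneg fun j _ => (hω j).le
  · refine (key k (Set.Iio u₀) measurableSet_Iio).trans ?_
    rw [Set.inter_comm, Set.Ioi_inter_Iio, Real.volume_Ioo, sub_zero]
  · refine (key k (Set.Ico m (m + 1)) measurableSet_Ico).trans ?_
    calc _ ≤ ENNReal.ofReal h₀ * volume (Set.Ico (m : ℝ) (m + 1)) := by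
          gcongr
          exact Set.inter_subset_left
      _ = _ := by simp

/-- If `h₀` were negative, the bound in `ℝ≥0∞` would be zero and no renewal could occur in `(0, ∞)`,
although the first one almost surely does. The sign is needed to read the constant `2 u₀ h₀` back in
`ℝ`. -/
theorem IsRenewalSampling.renewal_bound_nonneg {τ : ℕ → Ω → ℝ} {g : ℝ → ℝ} {h₀ : ℝ}
    (hS : IsRenewalSampling P X t τ g h₀) : 0 ≤ h₀ := by
  by_contra hneg
  have h1 := tsum_measure_sum_mem_le hS.measurable hS.indep hS.density hS.renewal_le 0
    measurableSet_Ioi (subset_refl (Set.Ioi (0 : ℝ)))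
  rw [ENNReal.ofReal_of_nonpos (not_le.1 hneg).le, zero_mul, nonpos_iff_eq_zero,
    ENNReal.tsum_eq_zero] at h1
  have h2 := h1 0
  simp only [zero_add, Finset.range_one, Finset.sum_singleton, Set.mem_Ioi] at h2
  have h3 : P {ω | 0 < τ 0 ω} = 1 := (prob_compl_eq_zero_iff
    (measurableSet_lt measurable_const (hS.measurable 0))).1 (hS.pos 0)
  simp [h2] at h3

theorem tsum_measure_le_card {A : ℕ → Set Ω} (I : Finset ℕ) (hA : ∀ i ∉ I, P (A i) = 0) :
    ∑' i, P (A i) ≤ I.card := by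
  rw [tsum_eq_sum hA]
  calc _ ≤ ∑ _i ∈ I, (1 : ℝ≥0∞) := Finset.sum_le_sum fun i _ => prob_le_one
    _ = I.card := by simp

theorem IsJitteredSampling.spacingBound {Z : ℕ → Ω → ℝ} {gJ : ℝ → ℝ} {δ : ℝ}
    (hS : IsJitteredSampling P X t Z gJ δ) (u₀ : ℝ) :
    SpacingBound P t u₀ (⌈u₀ / δ⌉₊ : ℝ≥0∞) ((⌈1 / δ⌉₊ + 4 : ℕ) : ℝ≥0∞) := by
  have hδ := hS.δ_pos
  have hZ : ∀ᵐ ω ∂P, ∀ k, |Z k ω| ≤ δ / 2 := by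
    refine ae_all_iff.2 fun k => ?_
    have h1 : ∀ᵐ z ∂(P.map (Z k)), z ∈ Set.Icc (-(δ / 2)) (δ / 2) := by
      rw [(hS.density k).eq_withDensity, ae_withDensity_iff (hS.density k).measurable.ennreal_ofReal]
      refine ae_of_all _ fun z hz => ?_
      by_contra hz'
      simp [hS.support z hz'] at hz
    filter_upwards [ae_of_ae_map (hS.measurable k).aemeasurable h1] with ω hω
    exact abs_le.2 hω
  -- The nominal spacing is `(i + 1) * δ`, and the two jitters change it by at most `δ`.
  have hdiff : ∀ᵐ ω ∂P, ∀ k i : ℕ, i * δ ≤ |t (k + 1 + i) ω - t k ω| ∧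
      |t (k + 1 + i) ω - t k ω| ≤ (i + 2) * δ := by
    filter_upwards [hZ] with ω hω k i
    have h1 := abs_le.1 (hω (k + 1 + i))
    have h2 := abs_le.1 (hω k)
    have h3 : (0 : ℝ) ≤ i * δ := by positivity
    rw [hS.time_eq, hS.time_eq]
    push_cast
    rw [abs_of_nonneg (by nlinarith)]
    constructor <;> nlinarith
  refine ⟨fun k => ?_, fun k hk => ?_, fun k => ?_, fun k m => ?_⟩
  · have : t k = fun ω => k * δ + Z k ω := funext fun ω => hS.time_eq k ω
    rw [this]
    exact (hS.measurable k).const_add _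
  · filter_upwards [hZ] with ω hω
    have h1 := abs_le.1 (hω k)
    have h2 : (1 : ℝ) ≤ k := by exact_mod_cast hk
    rw [hS.time_eq]
    nlinarith
  · refine (tsum_measure_le_card (Finset.range ⌈u₀ / δ⌉₊) fun i hi => ?_).trans_eq (by simp)
    have h1 : u₀ ≤ i * δ := by
      rw [Finset.mem_range, not_lt, Nat.ceil_le, div_le_iff₀ hδ] at hi
      exact hi
    have h2 : ∀ᵐ ω ∂P, ¬ |t (k + 1 + i) ω - t k ω| < u₀ := by
      filter_upwards [hdiff] with ω hω
      exact not_lt.2 (h1.trans (hω k i).1)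
    simpa [ae_iff] using h2
  -- Only indices with `m / δ - 2 ≤ i < (m + 1) / δ` contribute; their number is bounded
  -- independently of `m`.
  · refine (tsum_measure_le_card (Finset.Ico (⌈m / δ⌉₊ - 2) ⌈(m + 1) / δ⌉₊) fun i hi => ?_).trans ?_
    · have h2 : ∀ᵐ ω ∂P, ¬ ((m : ℝ) ≤ |t (k + 1 + i) ω - t k ω| ∧
          |t (k + 1 + i) ω - t k ω| < m + 1) := by
        filter_upwards [hdiff] with ω hω
        rintro ⟨h1, h2⟩
        refine hi (Finset.mem_Ico.2 ⟨?_, ?_⟩)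
        · rw [Nat.sub_le_iff_le_add, Nat.ceil_le, div_le_iff₀ hδ]
          push_cast
          exact h1.trans (hω k i).2
        · rw [Nat.lt_ceil, lt_div_iff₀ hδ]
          exact (hω k i).1.trans_lt h2
      simpa [ae_iff] using h2
    · rw [Nat.card_Ico]
      have h1 : ⌈((m : ℝ) + 1) / δ⌉₊ ≤ ⌈(m : ℝ) / δ⌉₊ + ⌈1 / δ⌉₊ := by
        rw [add_div]; exact Nat.ceil_add_le _ _
      exact_mod_cast (by omega :
        ⌈((m : ℝ) + 1) / δ⌉₊ - (⌈(m : ℝ) / δ⌉₊ - 2) ≤ ⌈1 / δ⌉₊ + 4)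

end Sampling

/-! ### Vanishing of the contribution of long lags -/

section Tail

/-- Bound for the summed covariances at a time lag in `[m, m + 1)`, in terms of the volume `η` of
the bins. -/
noncomputable def lagBound (K a₀ u₁ ρ η : ℝ) (m : ℕ) : ℝ :=
  if (m : ℝ) < u₁ then η * K else min (η * K) (4 * (a₀ * (m : ℝ) ^ (-ρ)))

variable {K a₀ u₁ ρ η : ℝ}

theorem lagBound_nonneg (hK : 0 ≤ K) (ha : 0 < a₀) (hη : 0 ≤ η) (m : ℕ) :
    0 ≤ lagBound K a₀ u₁ ρ η m := by
  unfold lagBound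
  split_ifs <;> positivity

theorem lagBound_le_mul (m : ℕ) : lagBound K a₀ u₁ ρ η m ≤ η * K := by
  unfold lagBound
  split_ifs
  exacts [le_rfl, min_le_left _ _]

/-- Dominated convergence for series: each term is at most `η n * K`, and once `η n < 1` all are
dominated by `K` at the finitely many `m < u₁` plus a multiple of `m ^ (-ρ)`. -/
theorem tendsto_tsum_lagBound (hK : 0 ≤ K) (ha : 0 < a₀) (hρ : 1 < ρ) {η : ℕ → ℝ}
    (hη : ∀ᶠ n in atTop, 0 ≤ η n) (hη0 : Tendsto η atTop (𝓝 0)) :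
    Tendsto (fun n => ∑' m, ENNReal.ofReal (lagBound K a₀ u₁ ρ (η n) m)) atTop (𝓝 0) := by
  set β : ℕ → ℝ := fun m => (if (m : ℝ) < u₁ then K else 0) + 4 * (a₀ * (m : ℝ) ^ (-ρ)) with hβ
  have hβs : Summable β := by
    refine Summable.add ?_ (((Real.summable_nat_rpow.2 (by linarith)).mul_left a₀).mul_left 4)
    refine summable_of_ne_finset_zero (s := Finset.range ⌈u₁⌉₊) fun m hm => ?_
    rw [Finset.mem_range, not_lt, Nat.ceil_le] at hm
    exact if_neg (not_lt.2 hm)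
  have hle : ∀ᶠ n in atTop, ∀ m, ‖lagBound K a₀ u₁ ρ (η n) m‖ ≤ β m := by
    filter_upwards [hη, hη0.eventually (gt_mem_nhds one_pos)] with n h0 h1 m
    rw [Real.norm_of_nonneg (lagBound_nonneg hK ha h0 m), lagBound]
    simp only [hβ]
    split_ifs
    · have : 0 ≤ 4 * (a₀ * (m : ℝ) ^ (-ρ)) := by positivity
      nlinarith
    · rw [zero_add]
      exact min_le_right _ _
  have hpt : ∀ m, Tendsto (fun n => lagBound K a₀ u₁ ρ (η n) m) atTop (𝓝 0) := by
    intro m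
    have h1 : Tendsto (fun n => η n * K) atTop (𝓝 0) := by simpa using hη0.mul_const K
    exact tendsto_of_tendsto_of_tendsto_of_le_of_le' tendsto_const_nhds h1
      (hη.mono fun n h0 => lagBound_nonneg hK ha h0 m) (Eventually.of_forall fun n =>
        lagBound_le_mul m)
  have h2 := tendsto_tsum_of_dominated_convergence hβs hpt hle
  rw [tsum_zero] at h2
  have h3 := ENNReal.tendsto_ofReal h2
  rw [ENNReal.ofReal_zero] at h3
  refine h3.congr' ?_
  filter_upwards [hη, hle] with n h0 h1
  exact ENNReal.ofReal_tsum_of_nonneg (fun m => lagBound_nonneg hK ha h0 m)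
    (Summable.of_norm_bounded hβs h1)

end Tail

/-! ### Summed variance of the bin counts -/

section Variance

variable {Ω : Type*} {mΩ : MeasurableSpace Ω} {P : Measure Ω}

theorem ofReal_integral_le_lintegral (F : Ω → ℝ) :
    ENNReal.ofReal (∫ ω, F ω ∂P) ≤ ∫⁻ ω, ENNReal.ofReal (F ω) ∂P := by
  by_cases hF : Integrable F P
  · rw [integral_eq_lintegral_pos_part_sub_lintegral_neg_part hF]
    exact (ENNReal.ofReal_le_ofReal (sub_le_self _ ENNReal.toReal_nonneg)).trans
      ENNReal.ofReal_toReal_le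
  · simp [integral_undef hF]

theorem sum_Ioc_le_tsum (F : ℕ → ℝ≥0∞) (k n : ℕ) :
    ∑ l ∈ Finset.Ioc k n, F l ≤ ∑' i, F (k + 1 + i) := by
  have h1 : Finset.Ioc k n = Finset.Ico (k + 1) (n + 1) := by ext; simp
  rw [h1, Finset.sum_Ico_eq_sum_range]
  exact ENNReal.sum_le_tsum _

variable {d : ℕ} {X : ℝ → Ω → (Fin d → ℝ)} {t : ℕ → Ω → ℝ}
  {f : (Fin d → ℝ) → ℝ} {fJ : ℝ → (Fin d → ℝ) → (Fin d → ℝ) → ℝ} {u₀ ρ h : ℝ}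

/-- The three covariance bounds in one inequality, written with indicators of lag windows so that
averaging over the times turns each indicator into a probability. -/
theorem MixingAssumption.exists_binCov_le [IsProbabilityMeasure P]
    (hX : IsPairStationary P X f fJ)
    (hA : MixingAssumption P X f fJ u₀ ρ) :
    ∃ K a₀ u₁ : ℝ, 0 ≤ K ∧ 0 < a₀ ∧ ∀ h, 0 < h → ∀ (b : Fin d → ℝ) (J : Finset (Fin d → ℤ))
      (s r : ℝ), ENNReal.ofReal (binCov P X h b J s r) ≤
        {u : ℝ | u < u₀}.indicator 1 |r - s| +
          ∑' m : ℕ, ENNReal.ofReal (lagBound K a₀ u₁ ρ (h ^ d) m) *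
            {u : ℝ | (m : ℝ) ≤ u ∧ u < m + 1}.indicator 1 |r - s| := by
  obtain ⟨k, hk0, hkc, hki, hdev⟩ := hA.deviation
  obtain ⟨a₀, u₁, ha, hu₁, hmix⟩ := hA.mixing
  refine ⟨∫ y, k y, a₀, u₁, integral_nonneg fun y => (hk0 y).le, ha, fun h hh b J s r => ?_⟩
  rcases lt_or_ge |r - s| u₀ with hu | hu
  · refine le_add_right ?_
    rw [Set.indicator_of_mem (show |r - s| ∈ {u : ℝ | u < u₀} from hu)]
    simpa using ENNReal.ofReal_le_ofReal (binCov_le_one hh b J hX.measurable s r)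
  · have hsr : s ≠ r := by
      rintro rfl
      rw [sub_self, abs_zero] at hu
      exact absurd hA.u₀_pos (not_lt.2 hu)
    have h1 := binCov_le_of_deviation (P := P) hX hh b J hk0 hkc hki hsr fun y z => hdev _ hu y z
    have h2 := binCov_le_alphaTwo (P := P) hh b J hX.measurable s r
    set m := ⌊|r - s|⌋₊ with hm
    have hm1 : (m : ℝ) ≤ |r - s| := Nat.floor_le (abs_nonneg _)
    have hm2 : |r - s| < m + 1 := Nat.lt_floor_add_one _
    refine le_add_left (le_trans ?_ (ENNReal.le_tsum m))
    rw [Set.indicator_of_mem (show |r - s| ∈ {u : ℝ | (m : ℝ) ≤ u ∧ u < m + 1} from ⟨hm1, hm2⟩),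
      Pi.one_apply, mul_one]
    refine ENNReal.ofReal_le_ofReal ?_
    unfold lagBound
    split_ifs with hmu
    · exact h1
    · rw [not_lt] at hmu
      -- Positivity of `m` allows the mixing rate, which decreases in the lag, to be evaluated at
      -- the floor.
      have hmpos : (0 : ℝ) < m := (hA.u₀_pos.trans hu₁).trans_le hmu
      refine le_min h1 (h2.trans ?_)
      gcongr
      refine (hmix _ (hmu.trans hm1)).trans ?_
      gcongr ?_ * ?_
      exact Real.rpow_le_rpow_of_nonpos hmpos hm1 (by linarith [hA.two_lt_ρ])

/-- Tonelli exchanges the sums over times and over windows; for each window the expected number of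
later times is then at most `C` or `D`. -/
theorem sum_lintegral_binCov_le {C D : ℝ≥0∞} (hS : SpacingBound P t u₀ C D) {A : ℕ → ℝ≥0∞}
    {b : Fin d → ℝ} {J : Finset (Fin d → ℤ)} (hA : ∀ s r, ENNReal.ofReal (binCov P X h b J s r) ≤
        {u : ℝ | u < u₀}.indicator 1 |r - s| +
          ∑' m : ℕ, A m * {u : ℝ | (m : ℝ) ≤ u ∧ u < m + 1}.indicator 1 |r - s|)
    {k : ℕ} (hk : 1 ≤ k) (n : ℕ) :
    ∑ l ∈ Finset.Ioc k n,
      ∫⁻ ω, ENNReal.ofReal (binCov P X h b J (t k ω).toNNReal (t l ω).toNNReal) ∂P ≤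
        C + D * ∑' m, A m := by
  have hmeas : ∀ l, Measurable fun ω => |t l ω - t k ω| := fun l =>
    continuous_abs.measurable.comp ((hS.measurable l).sub (hS.measurable k))
  have hms : ∀ l, MeasurableSet {ω | |t l ω - t k ω| < u₀} := fun l =>
    measurableSet_lt (hmeas l) measurable_const
  have hmm : ∀ l (m : ℕ), MeasurableSet {ω | (m : ℝ) ≤ |t l ω - t k ω| ∧
      |t l ω - t k ω| < m + 1} := fun l m =>
    (measurableSet_le measurable_const (hmeas l)).inter
      (measurableSet_lt (hmeas l) measurable_const)
  have h1 : ∀ l, 1 ≤ l →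
      ∫⁻ ω, ENNReal.ofReal (binCov P X h b J (t k ω).toNNReal (t l ω).toNNReal) ∂P ≤
        P {ω | |t l ω - t k ω| < u₀} + ∑' m : ℕ, A m *
          P {ω | (m : ℝ) ≤ |t l ω - t k ω| ∧ |t l ω - t k ω| < m + 1} := by
    intro l hl
    calc _ ≤ ∫⁻ ω, ({ω | |t l ω - t k ω| < u₀}.indicator 1 ω + ∑' m : ℕ, A m *
          {ω | (m : ℝ) ≤ |t l ω - t k ω| ∧ |t l ω - t k ω| < m + 1}.indicator 1 ω) ∂P := by
          refine lintegral_mono_ae ?_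
          filter_upwards [hS.nonneg k hk, hS.nonneg l hl] with ω hω1 hω2
          rw [Real.coe_toNNReal _ hω1, Real.coe_toNNReal _ hω2]
          exact hA _ _
      _ = _ := by
          rw [lintegral_add_left (measurable_one.indicator (hms l)),
            lintegral_tsum fun m =>
              ((measurable_one.indicator (hmm l m)).const_mul (A m)).aemeasurable,
            lintegral_indicator_one (hms l)]
          congr 1
          refine tsum_congr fun m => ?_
          rw [lintegral_const_mul _ (measurable_one.indicator (hmm l m)),
            lintegral_indicator_one (hmm l m)]
  calc _ ≤ ∑ l ∈ Finset.Ioc k n, (P {ω | |t l ω - t k ω| < u₀} + ∑' m : ℕ, A m *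
          P {ω | (m : ℝ) ≤ |t l ω - t k ω| ∧ |t l ω - t k ω| < m + 1}) :=
        Finset.sum_le_sum fun l hl => h1 l (hk.trans (Finset.mem_Ioc.1 hl).1.le)
    _ ≤ _ := sum_Ioc_le_tsum _ k n
    _ = ∑' i, P {ω | |t (k + 1 + i) ω - t k ω| < u₀} + ∑' m : ℕ, A m * ∑' i,
          P {ω | (m : ℝ) ≤ |t (k + 1 + i) ω - t k ω| ∧ |t (k + 1 + i) ω - t k ω| < m + 1} := by
        rw [ENNReal.tsum_add, ENNReal.tsum_comm]
        simp only [ENNReal.tsum_mul_left]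
    _ ≤ C + ∑' m : ℕ, A m * D := by
        gcongr with m
        · exact hS.short k
        · exact hS.unit k m
    _ = _ := by rw [ENNReal.tsum_mul_right, mul_comm]

theorem tsum_variance_binCount_le [IsProbabilityMeasure P]
    (hX : IsPairStationary P X f fJ) (hI : IndepOfProcess P X t)
    {C D : ℝ≥0∞} (hS : SpacingBound P t u₀ C D) {A : ℕ → ℝ≥0∞} (hh : 0 < h) {b : Fin d → ℝ}
    (hA : ∀ J s r, ENNReal.ofReal (binCov P X h b J s r) ≤
        {u : ℝ | u < u₀}.indicator 1 |r - s| +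
          ∑' m : ℕ, A m * {u : ℝ | (m : ℝ) ≤ u ∧ u < m + 1}.indicator 1 |r - s|) (n : ℕ) :
    ∑' j, ENNReal.ofReal Var[binCount X t n (bin h b j); P] ≤
      n * (1 + 2 * C + 2 * (D * ∑' m, A m)) := by
  rw [ENNReal.tsum_eq_iSup_sum]
  refine iSup_le fun J => ?_
  rw [← ENNReal.ofReal_sum_of_nonneg fun j _ => variance_nonneg _ _]
  refine (ENNReal.ofReal_le_ofReal
    (sum_variance_binCount_le hX hI hS.measurable hh b J n)).trans ?_
  refine ENNReal.ofReal_add_le.trans ?_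
  rw [ENNReal.ofReal_mul zero_le_two, ENNReal.ofReal_natCast, ENNReal.ofReal_ofNat]
  have hsum : ∀ (s : Finset ℕ) (F : ℕ → ℝ), ENNReal.ofReal (∑ i ∈ s, F i) ≤
      ∑ i ∈ s, ENNReal.ofReal (F i) := fun s F => by
    induction s using Finset.cons_induction with
    | empty => simp
    | cons i s hi ih =>
      rw [Finset.sum_cons, Finset.sum_cons]
      exact ENNReal.ofReal_add_le.trans (by gcongr)
  calc _ ≤ (n : ℝ≥0∞) + 2 * ∑ k ∈ Finset.Icc 1 n, (C + D * ∑' m, A m) := by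
        gcongr
        refine (hsum _ _).trans (Finset.sum_le_sum fun k hk => (hsum _ _).trans ?_)
        refine le_trans (Finset.sum_le_sum fun l _ => ofReal_integral_le_lintegral _) ?_
        exact sum_lintegral_binCov_le hS (hA J) (Finset.mem_Icc.1 hk).1 n
    _ = _ := by
        rw [Finset.sum_const, Nat.card_Icc, Nat.add_sub_cancel, nsmul_eq_mul]
        ring

end Variance

/-! ### Integrated variance and MISE as sums over the bins -/

section Histogram

variable {Ω : Type*} {mΩ : MeasurableSpace Ω} {P : Measure Ω}
  {d : ℕ} {X : ℝ → Ω → (Fin d → ℝ)} {t : ℕ → Ω → ℝ}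
  {f : (Fin d → ℝ) → ℝ} {fJ : ℝ → (Fin d → ℝ) → (Fin d → ℝ) → ℝ} {h : ℝ} {n : ℕ}

/-- `binCount` uses times truncated at zero; this agrees almost surely because only `k ≥ 1` enters.
The time `t 0` may be negative under jittering. -/
theorem ae_histogram_eq (ht : ∀ k, 1 ≤ k → ∀ᵐ ω ∂P, 0 ≤ t k ω) (hh : 0 < h) (b : Fin d → ℝ)
    (n : ℕ) : ∀ᵐ ω ∂P, ∀ j, ∀ x ∈ bin h b j,
      histogram X t n h b x ω = 1 / (n * h ^ d) * binCount X t n (bin h b j) ω := by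
  have h1 : ∀ᵐ ω ∂P, ∀ k, 1 ≤ k → 0 ≤ t k ω := by
    refine ae_all_iff.2 fun k => ?_
    by_cases hk : 1 ≤ k
    · filter_upwards [ht k hk] with ω hω _ using hω
    · exact ae_of_all _ fun ω hk' => absurd hk' hk
  filter_upwards [h1] with ω hω j x hx
  rw [histogram, tsum_eq_single j]
  · rw [Set.indicator_of_mem hx, mul_one, binCount]
    congr 1
    refine Finset.sum_congr rfl fun k hk => ?_
    rw [observed, Real.coe_toNNReal _ (hω k (Finset.mem_Icc.1 hk).1)]
  · intro i hi
    rw [Set.indicator_of_notMem (fun hx' => Set.disjoint_left.1 (pairwise_disjoint_bin hh hi)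
      hx' hx), mul_zero]

theorem real_preimage_eq_integral (hX : IsPairStationary P X f fJ) (s : ℝ)
    {A : Set (Fin d → ℝ)} (hA : MeasurableSet A) : P.real (X s ⁻¹' A) = ∫ x in A, f x := by
  rw [integral_eq_lintegral_of_nonneg_ae (ae_of_all _ (hX.marginal s).nonneg)
    (hX.marginal s).measurable.aestronglyMeasurable, Measure.real,
    ← Measure.map_apply (hX.measurable s) hA, (hX.marginal s).eq_withDensity,
    withDensity_apply _ hA]

variable [IsProbabilityMeasure P]

theorem memLp_binCount (hI : IndepOfProcess P X t) (ht : ∀ k, Measurable (t k)) (n : ℕ)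
    {A : Set (Fin d → ℝ)} (hA : MeasurableSet A) : MemLp (binCount X t n A) 2 P :=
  memLp_finsetSum _ fun k _ => memLp_indicator_preimage (measurable_observed hI ht k) hA

theorem integral_binCount_eq (hX : IsPairStationary P X f fJ) (hI : IndepOfProcess P X t)
    (ht : ∀ k, Measurable (t k)) (hn : 1 ≤ n) (b : Fin d → ℝ) (j : Fin d → ℤ) :
    ∫ ω, 1 / (n * h ^ d) * binCount X t n (bin h b j) ω ∂P = binAverage h b j f := by
  have hj : MeasurableSet (bin h b j) := measurableSet_bin j
  have hn' : (n : ℝ) ≠ 0 := by positivity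
  simp only [binCount]
  rw [integral_const_mul, integral_finsetSum]
  · simp only [integral_indicator_preimage (measurable_observed hI ht _) hj,
      real_preimage_observed hX hI ht _ hj, real_preimage_eq_integral hX 0 hj]
    rw [binAverage, Finset.sum_const, Nat.card_Icc, Nat.add_sub_cancel, nsmul_eq_mul]
    field_simp
  · exact fun k _ => (memLp_indicator_preimage (measurable_observed hI ht k) hj).integrable
      one_le_two

theorem lintegral_binCount_sub_sq (hX : IsPairStationary P X f fJ) (hI : IndepOfProcess P X t)
    (ht : ∀ k, Measurable (t k)) (hn : 1 ≤ n) (b : Fin d → ℝ) (j : Fin d → ℤ) :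
    ∫⁻ ω, ENNReal.ofReal
        ((1 / (n * h ^ d) * binCount X t n (bin h b j) ω - binAverage h b j f) ^ 2) ∂P =
      ENNReal.ofReal ((1 / (n * h ^ d)) ^ 2 * Var[binCount X t n (bin h b j); P]) := by
  have hM := memLp_binCount hI ht n (measurableSet_bin (h := h) (b := b) j)
  rw [← variance_const_mul, (hM.const_mul _).ofReal_variance_eq,
    evariance_eq_lintegral_ofReal, integral_binCount_eq hX hI ht hn]

theorem integratedVariance_histogram (hX : IsPairStationary P X f fJ)
    (hI : IndepOfProcess P X t) (ht : ∀ k, Measurable (t k))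
    (ht0 : ∀ k, 1 ≤ k → ∀ᵐ ω ∂P, 0 ≤ t k ω) (hn : 1 ≤ n) (hh : 0 < h) (b : Fin d → ℝ) :
    integratedVariance P (histogram X t n h b) = ∑' j, ENNReal.ofReal (h ^ d) *
      ENNReal.ofReal ((1 / (n * h ^ d)) ^ 2 * Var[binCount X t n (bin h b j); P]) := by
  have hae := ae_histogram_eq (X := X) ht0 hh b n
  rw [integratedVariance, lintegral_eq_tsum_bin hh b]
  refine tsum_congr fun j => ?_
  have h1 : ∀ x ∈ bin h b j, ∫⁻ ω, ENNReal.ofReal ((histogram X t n h b x ω -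
      ∫ ω', histogram X t n h b x ω' ∂P) ^ 2) ∂P = ENNReal.ofReal ((1 / (n * h ^ d)) ^ 2 *
        Var[binCount X t n (bin h b j); P]) := by
    intro x hx
    have h2 : ∫ ω', histogram X t n h b x ω' ∂P = binAverage h b j f := by
      rw [← integral_binCount_eq hX hI ht hn b j]
      refine integral_congr_ae ?_
      filter_upwards [hae] with ω hω using hω j x hx
    rw [h2, ← lintegral_binCount_sub_sq hX hI ht hn b j]
    refine lintegral_congr_ae ?_
    filter_upwards [hae] with ω hω
    rw [hω j x hx]
  rw [setLIntegral_congr_fun (measurableSet_bin j) h1, setLIntegral_const, volume_bin hh, mul_comm]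

/-- The mean integrated squared error is the integrated variance plus the integrated squared
bias. -/
theorem mise_histogram (hX : IsPairStationary P X f fJ) (hfc : Continuous f)
    (hI : IndepOfProcess P X t) (ht : ∀ k, Measurable (t k))
    (ht0 : ∀ k, 1 ≤ k → ∀ᵐ ω ∂P, 0 ≤ t k ω) (hn : 1 ≤ n) (hh : 0 < h) (b : Fin d → ℝ) :
    mise P (histogram X t n h b) f = integratedVariance P (histogram X t n h b) +
      ∑' j, ENNReal.ofReal (∫ x in bin h b j, (f x - binAverage h b j f) ^ 2) := by
  rw [integratedVariance_histogram hX hI ht ht0 hn hh b, ← ENNReal.tsum_add, mise]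
  have hbm : ∀ j, Measurable fun ω => ENNReal.ofReal
      ((1 / (n * h ^ d) * binCount X t n (bin h b j) ω - binAverage h b j f) ^ 2) := fun j => by
    have : Measurable (binCount X t n (bin h b j)) := Finset.measurable_fun_sum _ fun k _ =>
      (measurable_const.indicator (measurableSet_bin j)).comp (measurable_observed hI ht k)
    fun_prop
  have h1 : ∀ᵐ ω ∂P, ∫⁻ x, ENNReal.ofReal ((histogram X t n h b x ω - f x) ^ 2) =
      ∑' j, (ENNReal.ofReal (h ^ d) * ENNReal.ofReal
        ((1 / (n * h ^ d) * binCount X t n (bin h b j) ω - binAverage h b j f) ^ 2) +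
        ENNReal.ofReal (∫ x in bin h b j, (f x - binAverage h b j f) ^ 2)) := by
    filter_upwards [ae_histogram_eq (X := X) ht0 hh b n] with ω hω
    rw [lintegral_eq_tsum_bin hh b]
    refine tsum_congr fun j => ?_
    rw [setLIntegral_congr_fun (measurableSet_bin j) fun x hx => by rw [hω j x hx],
      ← ofReal_integral_eq_lintegral_ofReal (integrableOn_bin (by fun_prop) j)
        (ae_of_all _ fun x => sq_nonneg _), setIntegral_bin_sub_sq hh hfc,
      ENNReal.ofReal_add (by positivity) (integral_nonneg fun x => sq_nonneg _),
      ENNReal.ofReal_mul (by positivity)]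
  rw [lintegral_congr_ae h1, lintegral_tsum fun j =>
    (((hbm j).const_mul _).add_const _).aemeasurable]
  refine tsum_congr fun j => ?_
  rw [lintegral_add_right _ measurable_const, lintegral_const_mul _ (hbm j),
    lintegral_binCount_sub_sq hX hI ht hn b j, lintegral_const, measure_univ, mul_one]

end Histogram

/-! ### Asymptotic rates -/

section Rates

variable {Ω : Type*} {mΩ : MeasurableSpace Ω} {P : Measure Ω} [IsProbabilityMeasure P]
  {d : ℕ} {X : ℝ → Ω → (Fin d → ℝ)} {t : ℕ → Ω → ℝ}
  {f : (Fin d → ℝ) → ℝ} {fJ : ℝ → (Fin d → ℝ) → (Fin d → ℝ) → ℝ} {u₀ ρ : ℝ}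

theorem eventually_integratedVariance_le (hd : 1 ≤ d) (hX : IsPairStationary P X f fJ)
    (hA : MixingAssumption P X f fJ u₀ ρ) (hI : IndepOfProcess P X t) {C D : ℝ≥0∞}
    (hS : SpacingBound P t u₀ C D) (hD : D ≠ ∞) {h : ℕ → ℝ} (b : ℕ → Fin d → ℝ)
    (hh : ∀ n, 1 ≤ n → 0 < h n) (hh0 : Tendsto h atTop (𝓝 0)) {ε : ℝ≥0∞} (hε : 0 < ε) :
    ∀ᶠ n : ℕ in atTop, ENNReal.ofReal (n * h n ^ d) *
      integratedVariance P (histogram X t n (h n) (b n)) ≤ 1 + 2 * C + ε := by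
  obtain ⟨K, a₀, u₁, hK, ha, hbound⟩ := hA.exists_binCov_le hX
  have hη0 : Tendsto (fun n => h n ^ d) atTop (𝓝 0) := by
    simpa [zero_pow (Nat.one_le_iff_ne_zero.1 hd)] using hh0.pow d
  have hη : ∀ᶠ n in atTop, 0 ≤ h n ^ d := by
    filter_upwards [eventually_ge_atTop 1] with n hn using pow_nonneg (hh n hn).le d
  have hT := tendsto_tsum_lagBound (u₁ := u₁) (ρ := ρ) hK ha (by linarith [hA.two_lt_ρ]) hη hη0
  have hT2 : Tendsto (fun n => 2 * (D * ∑' m, ENNReal.ofReal (lagBound K a₀ u₁ ρ (h n ^ d) m)))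
      atTop (𝓝 0) := by
    have h1 := ENNReal.Tendsto.const_mul (a := 2)
      (ENNReal.Tendsto.const_mul hT (Or.inr hD)) (Or.inr ENNReal.ofNat_ne_top)
    simpa using h1
  filter_upwards [eventually_ge_atTop 1, hT2.eventually (gt_mem_nhds hε)] with n hn hTn
  have hhn := hh n hn
  have hn0 : (0 : ℝ) < n := by exact_mod_cast hn
  have hpow : 0 < h n ^ d := pow_pos hhn d
  have hV := tsum_variance_binCount_le (b := b n) hX hI hS hhn (hbound (h n) hhn (b n)) n
  rw [integratedVariance_histogram hX hI hS.measurable hS.nonneg hn hhn, ← ENNReal.tsum_mul_left]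
  -- All powers of `h n` cancel: `n h ^ d * h ^ d / (n h ^ d) ^ 2 = 1 / n`.
  have h1 : ∀ j, ENNReal.ofReal (n * h n ^ d) * (ENNReal.ofReal (h n ^ d) * ENNReal.ofReal
      ((1 / (n * h n ^ d)) ^ 2 * Var[binCount X t n (bin (h n) (b n) j); P])) =
      (n : ℝ≥0∞)⁻¹ * ENNReal.ofReal Var[binCount X t n (bin (h n) (b n) j); P] := by
    intro j
    rw [← ENNReal.ofReal_natCast n, ← ENNReal.ofReal_inv_of_pos hn0,
      ← ENNReal.ofReal_mul (by positivity), ← ENNReal.ofReal_mul (by positivity),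
      ← ENNReal.ofReal_mul (by positivity)]
    congr 1
    field_simp
  simp only [h1]
  rw [ENNReal.tsum_mul_left]
  calc _ ≤ (n : ℝ≥0∞)⁻¹ * (n * (1 + 2 * C + 2 * (D * ∑' m, ENNReal.ofReal
          (lagBound K a₀ u₁ ρ (h n ^ d) m)))) := by gcongr
    _ = 1 + 2 * C + 2 * (D * ∑' m, ENNReal.ofReal (lagBound K a₀ u₁ ρ (h n ^ d) m)) := by
        rw [← mul_assoc, ENNReal.inv_mul_cancel (by positivity) (by finiteness), one_mul]
    _ ≤ _ := by gcongr

theorem varianceRate_of_spacingBound (hd : 1 ≤ d) (hX : IsPairStationary P X f fJ)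
    (hA : MixingAssumption P X f fJ u₀ ρ) (hI : IndepOfProcess P X t) {C D : ℝ≥0∞}
    (hS : SpacingBound P t u₀ C D) (hD : D ≠ ∞) {c : ℝ} (hc : 1 + 2 * C = ENNReal.ofReal (1 + c)) :
    VarianceRate P X t c := by
  intro h b hh hh0 _
  refine ENNReal.le_of_forall_pos_le_add fun ε hε _ => ?_
  rw [← hc]
  exact limsup_le_of_le (h := eventually_integratedVariance_le hd hX hA hI hS hD b hh hh0
    (by exact_mod_cast hε))

theorem miseRate_of_spacingBound (hd : 1 ≤ d) (hX : IsPairStationary P X f fJ)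
    (hA : MixingAssumption P X f fJ u₀ ρ) (hI : IndepOfProcess P X t) {C D : ℝ≥0∞}
    (hS : SpacingBound P t u₀ C D) (hD : D ≠ ∞) {a : ℝ} (ha : 0 ≤ a)
    (hCa : 1 + 2 * C = ENNReal.ofReal (1 + a)) (hf : BiasAssumption f) :
    MISERate P X t f a := by
  intro c b hc
  have hR : 0 ≤ roughness f := Finset.sum_nonneg fun i _ => integral_nonneg fun x => sq_nonneg _
  set h : ℕ → ℝ := fun n => c * (n : ℝ) ^ (-1 / ((d : ℝ) + 2)) with hh
  have hpos : ∀ n, 1 ≤ n → 0 < h n := fun n hn => by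
    have : (0 : ℝ) < n := by exact_mod_cast hn
    positivity
  have hd2 : (0 : ℝ) < (d : ℝ) + 2 := by positivity
  have hh0 : Tendsto h atTop (𝓝 0) := by
    have h1 := ((tendsto_rpow_neg_atTop (one_div_pos.2 hd2)).comp
      tendsto_natCast_atTop_atTop).const_mul c
    simpa [hh, Function.comp_def, neg_div] using h1
  refine ENNReal.le_of_forall_pos_le_add fun ε hε _ => ?_
  -- After scaling by `c ^ 2` this tolerance costs `ε / 2`; so does `ε * c ^ d / 2` below, after
  -- division by `c ^ d`.
  obtain ⟨h₁, hh₁, hbias⟩ := exists_tsum_bin_bias_le hf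
    (show (0 : ℝ) < ε / (2 * c ^ 2) by positivity)
  refine limsup_le_of_le (h := ?_)
  filter_upwards [eventually_ge_atTop 1, hh0.eventually (gt_mem_nhds hh₁),
    eventually_integratedVariance_le hd hX hA hI hS hD b hpos hh0
      (show 0 < ENNReal.ofReal (ε * c ^ d / 2) from ENNReal.ofReal_pos.2 (by positivity))]
    with n hn hhn hIV
  have hn0 : (0 : ℝ) < n := by exact_mod_cast hn
  -- The bin width balances the two errors: the normalisation equals both `c ^ 2 / h ^ 2`, the scale
  -- of the bias, and `n h ^ d / c ^ d`, that of the variance.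
  have hsq : (n : ℝ) ^ (2 / ((d : ℝ) + 2)) * h n ^ 2 = c ^ 2 := by
    rw [hh]
    simp only
    rw [mul_pow, ← Real.rpow_natCast ((n : ℝ) ^ _) 2, ← Real.rpow_mul hn0.le, mul_left_comm,
      ← Real.rpow_add hn0]
    have : 2 / ((d : ℝ) + 2) + -1 / ((d : ℝ) + 2) * (2 : ℕ) = 0 := by push_cast; ring
    rw [this, Real.rpow_zero, mul_one]
  have hvol : (n : ℝ) ^ (2 / ((d : ℝ) + 2)) = 1 / c ^ d * (n * h n ^ d) := by
    rw [hh]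
    simp only
    have hcancel : ∀ y : ℝ, 1 / c ^ d * (n * (c ^ d * y)) = n * y := fun y => by field_simp
    rw [mul_pow, ← Real.rpow_natCast ((n : ℝ) ^ _) d, ← Real.rpow_mul hn0.le, hcancel]
    conv_rhs => rw [← Real.rpow_one (n : ℝ), ← Real.rpow_mul hn0.le, ← Real.rpow_add hn0]
    congr 1
    field_simp
    ring
  rw [mise_histogram hX hf.contDiff.continuous hI hS.measurable hS.nonneg hn (hpos n hn), mul_add]
  calc _ ≤ ENNReal.ofReal (1 / c ^ d) * ENNReal.ofReal (1 + a + ε * c ^ d / 2) +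
        ENNReal.ofReal (c ^ 2 * (roughness f / 12 + ε / (2 * c ^ 2))) := by
        refine add_le_add ?_ ?_
        · rw [hvol, ENNReal.ofReal_mul (by positivity), mul_assoc,
            ENNReal.ofReal_add (by positivity) (by positivity), ← hCa]
          gcongr
        · refine (mul_le_mul_right (hbias (h n) (hpos n hn) hhn (b n)) _).trans_eq ?_
          rw [← ENNReal.ofReal_mul (by positivity), ← mul_assoc, hsq]
    _ = _ := by
        rw [← ENNReal.ofReal_mul (by positivity), ← ENNReal.ofReal_add (by positivity)
          (by positivity), ← ENNReal.ofReal_coe_nnreal (p := ε), ← ENNReal.ofReal_add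
          (by positivity) (by positivity)]
        congr 1
        field_simp
        ring

end Rates

end SampledHistogram

theorem mainTheorem1 {Ω : Type*} {mΩ : MeasurableSpace Ω} (P : Measure Ω) [IsProbabilityMeasure P]
    (d : ℕ) (hd : 1 ≤ d) (X : ℝ → Ω → (Fin d → ℝ)) (f : (Fin d → ℝ) → ℝ)
    (fJ : ℝ → (Fin d → ℝ) → (Fin d → ℝ) → ℝ)
    (hX : SampledHistogram.IsPairStationary P X f fJ)
    (hf : SampledHistogram.BoundedDensity f)
    (u₀ ρ : ℝ) (hA : SampledHistogram.MixingAssumption P X f fJ u₀ ρ)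
    (p : ℝ) (hp : 1 < p) (hpρ : p < ρ - 1)
    (hf_smooth : ContDiff ℝ 1 (fun x => f x ^ (1 - 1 / p)))
    (hf_int : Integrable (fun x => f x ^ (1 - 1 / p))) :
    (∀ (t τ : ℕ → Ω → ℝ) (g : ℝ → ℝ) (h₀ : ℝ),
      SampledHistogram.IsRenewalSampling P X t τ g h₀ →
        SampledHistogram.VarianceRate P X t (2 * u₀ * h₀) ∧
        (SampledHistogram.BiasAssumption f →
          SampledHistogram.MISERate P X t f (2 * u₀ * h₀))) ∧
    (∀ (t Z : ℕ → Ω → ℝ) (gJ : ℝ → ℝ) (δ : ℝ),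
      SampledHistogram.IsJitteredSampling P X t Z gJ δ →
        SampledHistogram.VarianceRate P X t (2 * (⌈u₀ / δ⌉ : ℝ)) ∧
        (SampledHistogram.BiasAssumption f →
          SampledHistogram.MISERate P X t f (2 * (⌈u₀ / δ⌉ : ℝ)))) := by
  refine ⟨fun t τ g h₀ hS => ?_, fun t Z gJ δ hS => ?_⟩
  · have hh₀ := hS.renewal_bound_nonneg
    have hu₀ := hA.u₀_pos
    have hC : 1 + 2 * (ENNReal.ofReal h₀ * ENNReal.ofReal u₀) =
        ENNReal.ofReal (1 + 2 * u₀ * h₀) := by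
      rw [ENNReal.ofReal_add zero_le_one (by positivity), ENNReal.ofReal_one, mul_assoc,
        ENNReal.ofReal_mul zero_le_two, ENNReal.ofReal_mul hu₀.le, ENNReal.ofReal_ofNat,
        mul_comm (ENNReal.ofReal h₀)]
    exact ⟨SampledHistogram.varianceRate_of_spacingBound hd hX hA hS.indep_process
        (hS.spacingBound u₀) ENNReal.ofReal_ne_top hC,
      SampledHistogram.miseRate_of_spacingBound hd hX hA hS.indep_process
        (hS.spacingBound u₀) ENNReal.ofReal_ne_top (by positivity) hC⟩
  · have hpos : 0 ≤ u₀ / δ := (div_pos hA.u₀_pos hS.δ_pos).le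
    -- The natural and integer ceilings agree because `u₀ / δ` is nonnegative.
    have hC : 1 + 2 * (⌈u₀ / δ⌉₊ : ℝ≥0∞) = ENNReal.ofReal (1 + 2 * (⌈u₀ / δ⌉ : ℝ)) := by
      rw [← natCast_ceil_eq_intCast_ceil hpos, ENNReal.ofReal_add zero_le_one (by positivity),
        ENNReal.ofReal_one, ENNReal.ofReal_mul zero_le_two, ENNReal.ofReal_ofNat,
        ENNReal.ofReal_natCast]
    have hceil : (0 : ℝ) ≤ 2 * (⌈u₀ / δ⌉ : ℝ) := by
      rw [← natCast_ceil_eq_intCast_ceil hpos]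
      positivity
    exact ⟨SampledHistogram.varianceRate_of_spacingBound hd hX hA hS.indep_process
        (hS.spacingBound u₀) (ENNReal.natCast_ne_top _) hC,
      SampledHistogram.miseRate_of_spacingBound hd hX hA hS.indep_process
        (hS.spacingBound u₀) (ENNReal.natCast_ne_top _) hceil hC⟩
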